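/- **Notation.** For $k\ge 2$ let $\omega^{\uparrow\le k}$ (resp. $\omega^{\uparrow k}$) be the set of non-decreasing sequences of natural numbers of length at most $k$ (resp. exactly $k$). Let $s\sqsubset t$ mean that $s$ is a proper initial segment of $t$. Order $\omega^{\uparrow\le k}$ by $\prec$: the empty sequence is the minimum, and for nonempty sequences $(s_1,\dots,s_i)\prec(t_1,\dots,t_j)$ iff $s_i<t_j$, or $s_i=t_j$ and $(s_1,\dots,s_i)$ is lexicographically below $(t_1,\dots,t_j)$ (a proper initial segment of a sequence being lexicographically below it). Let $\mathcal E_k$ be the collection of all sets $\widehat X[\omega^{\uparrow k}]$, where $\widehat X:\omega^{\uparrow\le k}\to\omega^{\uparrow\le k}$ preserves $\prec$ and $\sqsubset$. For $n\ge 1$ let $\mathcal{AR}^k_n$ be the collection of the sets $r_n(X)$, $X\in\mathcal E_k$, where $r_n(X)$ consists of the $\prec$-least $n$ members of $X$; put $\mathcal{AR}^k=\bigcup_{n\ge1}\mathcal{AR}^k_n$ and, for a positive integer $d$, $\mathcal A^k_d=\bigcup_{i=1}^d\mathcal{AR}^k_i$. For $1\le m\le d$, a sequence $(E_i)_{i=1}^m$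 in $\mathcal{AR}^k$ is $\mathcal A^k_d$-admissible if there is $\{v_1,\dots,v_m\}\in\mathcal A^k_d$ with $v_1\le E_1<v_2\le E_2<\dots<v_m\le E_m$, where $v\le E$ means $v\preceq\min_\prec E$ and $E<v$ means $\max_\prec E\prec v$. Let $0<\theta<1$. For a finitely supported $x:\omega^{\uparrow k}\to\mathbb R$ put $|x|_0=\max_v|x(v)|$ and $$|x|_{j+1}=\max\Big\{|x|_j,\ \theta\max\Big\{\sum_{i=1}^m|E_ix|_j:\ 1\le m\le d,\ (E_i)_{i=1}^m\ \mathcal A^k_d\text{-admissible}\Big\}\Big\},$$ where $E_ix$ is the restriction of $x$ to $E_i$ (extended by $0$). The Banach space $T(\mathcal A^k_d,\theta)$ is the completion of the space $c_{00}(\omega^{\uparrow k})$ of finitely supported real functions under the norm $\|x\|=\sup_j|x|_j$. **Theorem.** Let $d$ be a positive integer and $0<\theta<1$ with $d\theta>1$, and let $k_1,k_2\ge 2$ be integers. If $k_1\ne k_2$, then $T(\mathcal A_d^{k_1},\theta)$ and $T(\mathcal A_d^{k_2},\theta)$ are not isomorphic, i.e. there is no linear homeomorphism of one onto the other. -/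

import Mathlib

namespace EllentuckBanach

/-- The non-decreasing sequences of natural numbers of length at most `k`. -/
abbrev OmegaLE (k : ℕ) : Type := {s : List ℕ // s.length ≤ k ∧ s.Pairwise (· ≤ ·)}

/-- The non-decreasing sequences of natural numbers of length exactly `k`. -/
abbrev Omega (k : ℕ) : Type := {s : List ℕ // s.length = k ∧ s.Pairwise (· ≤ ·)}

/-- The inclusion of the sequences of length `k` into those of length at most `k`. -/
def Omega.toLE {k : ℕ} (v : Omega k) : OmegaLE k := ⟨v.1, v.2.1.le, v.2.2⟩

/-- The well-order `≺`: the empty sequence comes first; two nonempty sequences are compared by their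
last terms and then lexicographically (`<` on lists is the lexicographic order, in which a proper
initial segment of a sequence lies below that sequence). -/
def Prec (s t : List ℕ) : Prop :=
  (s = [] ∧ t ≠ []) ∨
    ∃ (hs : s ≠ []) (ht : t ≠ []),
      s.getLast hs < t.getLast ht ∨ (s.getLast hs = t.getLast ht ∧ s < t)

/-- `s ⊏ t`: `s` is a proper initial segment of `t`. -/
def ProperInit (s t : List ℕ) : Prop := s <+: t ∧ s ≠ t

/-- An `ℰ_k`-tree: a self-map of the sequences of length at most `k` that preserves `≺` and `⊏`. -/
def IsEllentuckTree (k : ℕ) (f : OmegaLE k → OmegaLE k) : Prop :=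
  (∀ s t, Prec s.1 t.1 → Prec (f s).1 (f t).1) ∧
    ∀ s t, ProperInit s.1 t.1 → ProperInit (f s).1 (f t).1

/-- The space `ℰ_k`; a member is identified with its range: the set of values, on the sequences of
length `k`, of an `ℰ_k`-tree. -/
def ellentuckSpace (k : ℕ) : Set (Set (Omega k)) :=
  {X | ∃ f : OmegaLE k → OmegaLE k, IsEllentuckTree k f ∧
    X = {v | ∃ u : Omega k, (f u.toLE).1 = v.1}}

/-- `𝒜ℛ_n^k`: the sets consisting of the `≺`-least `n` members of some `X ∈ ℰ_k`. -/
def approxOfSize (k n : ℕ) : Set (Finset (Omega k)) :=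
  {F | ∃ X ∈ ellentuckSpace k, F.card = n ∧ (∀ v ∈ F, v ∈ X) ∧
    ∀ v ∈ F, ∀ w ∈ X, Prec w.1 v.1 → w ∈ F}

/-- `𝒜ℛ^k`: the nonempty finite approximations to members of `ℰ_k`. -/
def approx (k : ℕ) : Set (Finset (Omega k)) := {F | ∃ n, 1 ≤ n ∧ F ∈ approxOfSize k n}

/-- `𝒜_d^k`, the union of the `𝒜ℛ_i^k` for `1 ≤ i ≤ d`. -/
def lowApprox (k d : ℕ) : Set (Finset (Omega k)) :=
  {F | ∃ i, 1 ≤ i ∧ i ≤ d ∧ F ∈ approxOfSize k i}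

/-- `(E_i)` is `𝒜_d^k`-admissible: there is `{v_1, …, v_m} ∈ 𝒜_d^k` with
`v_1 ≤ E_1 < v_2 ≤ E_2 < ⋯ < v_m ≤ E_m`. -/
def Admissible (k d : ℕ) {m : ℕ} (E : Fin m → Finset (Omega k)) : Prop :=
  1 ≤ m ∧ m ≤ d ∧ (∀ i, E i ∈ approx k) ∧
    ∃ v : Fin m → Omega k, Finset.univ.image v ∈ lowApprox k d ∧
      (∀ i, ∀ w ∈ E i, v i = w ∨ Prec (v i).1 w.1) ∧
      ∀ i j, i < j → ∀ w ∈ E i, Prec w.1 (v j).1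

/-- `Ex`, the restriction of a finitely supported `x` to `E`. -/
noncomputable def restrict {k : ℕ} (E : Finset (Omega k)) (x : Omega k →₀ ℝ) : Omega k →₀ ℝ :=
  x.filter (· ∈ E)

/-- The norms `|x|_j`. -/
noncomputable def normStep (k d : ℕ) (θ : ℝ) : ℕ → (Omega k →₀ ℝ) → ℝ
  | 0, x => ⨆ v, |x v|
  | j + 1, x => max (normStep k d θ j x)
      (θ * sSup {r | ∃ (m : ℕ) (E : Fin m → Finset (Omega k)), Admissible k d E ∧
        r = ∑ i, normStep k d θ j (restrict (E i) x)})

/-- The norm `sup_j |x|_j`. -/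
noncomputable def tsirelsonNorm (k d : ℕ) (θ : ℝ) (x : Omega k →₀ ℝ) : ℝ :=
  ⨆ j, normStep k d θ j x

theorem Prec.irrefl (s : List ℕ) : ¬ Prec s s := by
  rintro (⟨h, h'⟩ | ⟨_, _, h | ⟨_, h⟩⟩)
  · exact h' h
  · exact lt_irrefl _ h
  · exact lt_irrefl _ h

theorem Prec.asymm {s t : List ℕ} (h : Prec s t) (h' : Prec t s) : False := by
  rcases h with ⟨h1, h2⟩ | ⟨h1, h2, h3⟩
  · rcases h' with ⟨h4, _⟩ | ⟨_, h5, _⟩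
    · exact h2 h4
    · exact h5 h1
  · rcases h' with ⟨h4, _⟩ | ⟨_, _, h6⟩
    · exact h2 h4
    · rcases h3 with h3 | ⟨h3, h3'⟩ <;> rcases h6 with h6 | ⟨h6, h6'⟩
      · omega
      · omega
      · omega
      · exact lt_asymm h3' h6'

theorem Admissible.disjoint {k d m : ℕ} {E : Fin m → Finset (Omega k)} (h : Admissible k d E)
    {i j : Fin m} {w : Omega k} (hi : w ∈ E i) (hj : w ∈ E j) : i = j := by
  obtain ⟨_, _, _, v, _, h1, h2⟩ := h
  have key : ∀ a b : Fin m, a < b → w ∈ E a → w ∈ E b → False := by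
    intro a b hab ha hb
    have h3 := h2 a b hab w ha
    rcases h1 b w hb with h4 | h4
    · rw [h4] at h3
      exact Prec.irrefl _ h3
    · exact Prec.asymm h3 h4
  rcases lt_trichotomy i j with h3 | h3 | h3
  · exact (key i j h3 hi hj).elim
  · exact h3
  · exact (key j i h3 hj hi).elim

theorem restrict_apply {k : ℕ} (E : Finset (Omega k)) (x : Omega k →₀ ℝ) (v : Omega k) :
    restrict E x v = if v ∈ E then x v else 0 := by
  simp [restrict, Finsupp.filter_apply]

theorem restrict_add {k : ℕ} (E : Finset (Omega k)) (x y : Omega k →₀ ℝ) :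
    restrict E (x + y) = restrict E x + restrict E y := by
  ext v
  simp only [restrict_apply, Finsupp.add_apply]
  split_ifs <;> simp

theorem restrict_smul {k : ℕ} (E : Finset (Omega k)) (c : ℝ) (x : Omega k →₀ ℝ) :
    restrict E (c • x) = c • restrict E x := by
  ext v
  simp only [restrict_apply, Finsupp.smul_apply]
  split_ifs <;> simp

/-- The `ℓ_1`-norm, an upper bound for all the norms `|x|_j`. -/
noncomputable def l1Norm {k : ℕ} (x : Omega k →₀ ℝ) : ℝ := ∑ v ∈ x.support, |x v|

theorem l1Norm_nonneg {k : ℕ} (x : Omega k →₀ ℝ) : 0 ≤ l1Norm x :=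
  Finset.sum_nonneg fun _ _ => abs_nonneg _

theorem abs_le_l1Norm {k : ℕ} (x : Omega k →₀ ℝ) (v : Omega k) : |x v| ≤ l1Norm x := by
  by_cases h : v ∈ x.support
  · exact Finset.single_le_sum (f := fun v => |x v|) (fun _ _ => abs_nonneg _) h
  · have : x v = 0 := by simpa using h
    rw [this, abs_zero]
    exact l1Norm_nonneg x

theorem bddAbove_abs {k : ℕ} (x : Omega k →₀ ℝ) : BddAbove (Set.range fun v => |x v|) :=
  ⟨l1Norm x, by rintro _ ⟨v, rfl⟩; exact abs_le_l1Norm x v⟩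

theorem l1Norm_restrict {k : ℕ} (E : Finset (Omega k)) (x : Omega k →₀ ℝ) :
    l1Norm (restrict E x) = ∑ v ∈ x.support, if v ∈ E then |x v| else 0 := by
  have h : (restrict E x).support ⊆ x.support := by
    intro v hv
    rw [Finsupp.mem_support_iff, restrict_apply] at hv
    rw [Finsupp.mem_support_iff]
    intro h0
    simp [h0] at hv
  unfold l1Norm
  rw [Finset.sum_subset h]
  · refine Finset.sum_congr rfl fun v _ => ?_
    rw [restrict_apply]
    split_ifs <;> simp
  · intro v _ hv
    have : restrict E x v = 0 := by simpa using hv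
    rw [this, abs_zero]

theorem sum_l1Norm_restrict_le {k d m : ℕ} {E : Fin m → Finset (Omega k)}
    (h : Admissible k d E) (x : Omega k →₀ ℝ) :
    ∑ i, l1Norm (restrict (E i) x) ≤ l1Norm x := by
  simp only [l1Norm_restrict]
  rw [Finset.sum_comm]
  refine Finset.sum_le_sum fun v _ => ?_
  by_cases hv : ∃ i, v ∈ E i
  · obtain ⟨i, hi⟩ := hv
    rw [Finset.sum_eq_single i]
    · simp [hi]
    · intro j _ hj
      rw [if_neg]
      intro hvj
      exact hj (h.disjoint hvj hi)
    · simp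
  · push Not at hv
    simp [hv]

theorem normStep_nonneg (k d : ℕ) (θ : ℝ) (j : ℕ) (x : Omega k →₀ ℝ) :
    0 ≤ normStep k d θ j x := by
  induction j with
  | zero => exact Real.iSup_nonneg fun _ => abs_nonneg _
  | succ j ih => exact ih.trans (le_max_left _ _)

theorem normStep_le_l1Norm (k d : ℕ) {θ : ℝ} (h0 : 0 < θ) (h1 : θ < 1) (j : ℕ) :
    ∀ x : Omega k →₀ ℝ, normStep k d θ j x ≤ l1Norm x := by
  induction j with
  | zero => exact fun x => Real.iSup_le (abs_le_l1Norm x) (l1Norm_nonneg x)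
  | succ j ih =>
    intro x
    refine max_le (ih x) ?_
    have h : sSup {r | ∃ (m : ℕ) (E : Fin m → Finset (Omega k)), Admissible k d E ∧
        r = ∑ i, normStep k d θ j (restrict (E i) x)} ≤ l1Norm x := by
      refine Real.sSup_le ?_ (l1Norm_nonneg x)
      rintro _ ⟨m, E, hE, rfl⟩
      exact (Finset.sum_le_sum fun i _ => ih _).trans (sum_l1Norm_restrict_le hE x)
    nlinarith [l1Norm_nonneg x]

theorem bddAbove_sums (k d : ℕ) {θ : ℝ} (h0 : 0 < θ) (h1 : θ < 1) (j : ℕ) (x : Omega k →₀ ℝ) :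
    BddAbove {r | ∃ (m : ℕ) (E : Fin m → Finset (Omega k)), Admissible k d E ∧
        r = ∑ i, normStep k d θ j (restrict (E i) x)} := by
  refine ⟨l1Norm x, ?_⟩
  rintro _ ⟨m, E, hE, rfl⟩
  exact (Finset.sum_le_sum fun i _ => normStep_le_l1Norm k d h0 h1 j _).trans
    (sum_l1Norm_restrict_le hE x)

theorem normStep_add_le (k d : ℕ) {θ : ℝ} (h0 : 0 < θ) (h1 : θ < 1) (j : ℕ) :
    ∀ x y : Omega k →₀ ℝ,
      normStep k d θ j (x + y) ≤ normStep k d θ j x + normStep k d θ j y := by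
  induction j with
  | zero =>
    intro x y
    refine Real.iSup_le (fun v => ?_)
      (add_nonneg (normStep_nonneg k d θ 0 x) (normStep_nonneg k d θ 0 y))
    exact (abs_add_le _ _).trans
      (add_le_add (le_ciSup (bddAbove_abs x) v) (le_ciSup (bddAbove_abs y) v))
  | succ j ih =>
    intro x y
    refine max_le ((ih x y).trans (add_le_add (le_max_left _ _) (le_max_left _ _))) ?_
    refine le_trans ?_ (add_le_add (le_max_right _ _) (le_max_right _ _))
    rw [← mul_add]
    refine mul_le_mul_of_nonneg_left ?_ h0.le
    have hnn : ∀ z : Omega k →₀ ℝ,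
        0 ≤ sSup {r | ∃ (m : ℕ) (E : Fin m → Finset (Omega k)), Admissible k d E ∧
          r = ∑ i, normStep k d θ j (restrict (E i) z)} := by
      intro z
      refine Real.sSup_nonneg ?_
      rintro _ ⟨m, E, _, rfl⟩
      exact Finset.sum_nonneg fun i _ => normStep_nonneg k d θ j _
    refine Real.sSup_le ?_ (add_nonneg (hnn x) (hnn y))
    rintro _ ⟨m, E, hE, rfl⟩
    refine le_trans ?_ (add_le_add
      (le_csSup (bddAbove_sums k d h0 h1 j x) ⟨m, E, hE, rfl⟩)
      (le_csSup (bddAbove_sums k d h0 h1 j y) ⟨m, E, hE, rfl⟩))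
    rw [← Finset.sum_add_distrib]
    refine Finset.sum_le_sum fun i _ => ?_
    rw [restrict_add]
    exact ih _ _

theorem normStep_smul (k d : ℕ) (θ : ℝ) (j : ℕ) :
    ∀ (c : ℝ) (x : Omega k →₀ ℝ), normStep k d θ j (c • x) = |c| * normStep k d θ j x := by
  induction j with
  | zero =>
    intro c x
    simp only [normStep, Finsupp.smul_apply, smul_eq_mul, abs_mul]
    rw [Real.mul_iSup_of_nonneg (abs_nonneg c)]
  | succ j ih =>
    intro c x
    simp only [normStep, restrict_smul, ih, ← Finset.mul_sum]
    rw [mul_max_of_nonneg _ _ (abs_nonneg c), mul_left_comm |c| θ]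
    congr 2
    rw [← smul_eq_mul, ← Real.sSup_smul_of_nonneg (abs_nonneg c)]
    congr 1
    ext r
    simp only [Set.mem_ofPred_eq, Set.mem_smul_set, smul_eq_mul]
    constructor
    · rintro ⟨m, E, hE, rfl⟩
      exact ⟨_, ⟨m, E, hE, rfl⟩, rfl⟩
    · rintro ⟨_, ⟨m, E, hE, rfl⟩, rfl⟩
      exact ⟨m, E, hE, rfl⟩

theorem bddAbove_normStep (k d : ℕ) {θ : ℝ} (h0 : 0 < θ) (h1 : θ < 1) (x : Omega k →₀ ℝ) :
    BddAbove (Set.range fun j => normStep k d θ j x) :=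
  ⟨l1Norm x, by rintro _ ⟨j, rfl⟩; exact normStep_le_l1Norm k d h0 h1 j x⟩

/-- The space `c₀₀` of finitely supported real functions on the sequences of length `k`, to be
normed by `tsirelsonNorm k d θ`. -/
def C00 (k _d : ℕ) (_θ : Set.Ioo (0 : ℝ) 1) : Type := Omega k →₀ ℝ

noncomputable instance (k d : ℕ) (θ : Set.Ioo (0 : ℝ) 1) : AddCommGroup (C00 k d θ) :=
  inferInstanceAs (AddCommGroup (Omega k →₀ ℝ))

noncomputable instance (k d : ℕ) (θ : Set.Ioo (0 : ℝ) 1) : Module ℝ (C00 k d θ) :=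
  inferInstanceAs (Module ℝ (Omega k →₀ ℝ))

noncomputable instance (k d : ℕ) (θ : Set.Ioo (0 : ℝ) 1) : Norm (C00 k d θ) :=
  ⟨fun x => tsirelsonNorm k d θ x⟩

theorem C00.core (k d : ℕ) (θ : Set.Ioo (0 : ℝ) 1) : NormedSpace.Core ℝ (C00 k d θ) where
  norm_nonneg x := Real.iSup_nonneg fun j => normStep_nonneg k d θ j x
  norm_smul c x := by
    change (⨆ j, normStep k d θ j (c • (show Omega k →₀ ℝ from x))) =
      ‖c‖ * ⨆ j, normStep k d θ j x
    rw [Real.mul_iSup_of_nonneg (norm_nonneg c), Real.norm_eq_abs]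
    exact congrArg iSup (funext fun j => normStep_smul k d θ j c x)
  norm_triangle x y := by
    refine ciSup_le fun j => (normStep_add_le k d θ.2.1 θ.2.2 j x y).trans ?_
    exact add_le_add (le_ciSup (bddAbove_normStep k d θ.2.1 θ.2.2 x) j)
      (le_ciSup (bddAbove_normStep k d θ.2.1 θ.2.2 y) j)
  norm_eq_zero_iff x := by
    constructor
    · intro h
      refine Finsupp.ext fun v => ?_
      have h1 : normStep k d θ 0 x ≤ tsirelsonNorm k d θ x :=
        le_ciSup (bddAbove_normStep k d θ.2.1 θ.2.2 x) 0
      have h2 : |(show Omega k →₀ ℝ from x) v| ≤ normStep k d θ 0 x :=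
        le_ciSup (bddAbove_abs (show Omega k →₀ ℝ from x)) v
      have h3 : tsirelsonNorm k d θ x = 0 := h
      exact abs_eq_zero.1 (le_antisymm (h2.trans (h1.trans h3.le)) (abs_nonneg _))
    · rintro rfl
      change (⨆ j, normStep k d θ j (0 : Omega k →₀ ℝ)) = 0
      have : ∀ j, normStep k d θ j (0 : Omega k →₀ ℝ) = 0 := by
        intro j
        have := normStep_smul k d θ j 0 (0 : Omega k →₀ ℝ)
        simpa using this
      simp [this]

noncomputable instance (k d : ℕ) (θ : Set.Ioo (0 : ℝ) 1) : NormedAddCommGroup (C00 k d θ) :=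
  NormedAddCommGroup.ofCore (C00.core k d θ)

noncomputable instance (k d : ℕ) (θ : Set.Ioo (0 : ℝ) 1) : NormedSpace ℝ (C00 k d θ) :=
  NormedSpace.ofCore (C00.core k d θ)

/-- The Banach space `T(𝒜_d^k, θ)`: the completion of `c₀₀` in the norm `tsirelsonNorm k d θ`. -/
abbrev TsirelsonSpace (k d : ℕ) (θ : Set.Ioo (0 : ℝ) 1) : Type :=
  UniformSpace.Completion (C00 k d θ)

end EllentuckBanach

namespace EllentuckBanach

/-! By symmetry it suffices to exclude an isomorphism from the space with index `K` onto the one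
with index `k < K`. Its values on the unit vectors are perturbed to finitely supported `y u`,
bounded away from zero, whose finite sums are dominated by the corresponding sums of unit vectors,
up to an additive constant (`isEmpty_equiv_of_lt`).

Two estimates pull against each other. Unit vectors far out in distinct branches above one node span
`ℓ_∞^n` uniformly, because an approximation that starts beyond the branching nodes meets at most one
of the branches (`tsirelsonNorm_le_of_branches`). But `d ^ j` vectors in successive, well separated
bands above one node have a sum of norm at least `(dθ) ^ j` times their common lower bound, because
each block of bands fits into one approximation and there is room for the separating points
(`exists_pow_mul_le_tsirelsonNorm`); this is unbounded as `dθ > 1`.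

Suppose that the parts of `y u` above every child of a node `p` vanish as the terms of `u` go to
infinity one after the other. If the part above `p` did not vanish after one further limit, vectors
`y u` could be chosen, with the `u` in distinct branches, whose parts above `p` live essentially in
successive bands. Their sum would be large by the second estimate and bounded by the first. So
smallness passes from the children of `p` to `p` at the price of one more limit
(`eventually_branchPart_lt_succ`). It starts, with one limit, at nodes of length `k`, that is at
single coordinates, since sums of `N` unit vectors have norm `o(N)` (`exists_card_le_of_le_abs`).
After `k + 1` limits the root is reached and the whole of `y u` is small. A sequence `u` of length
`K` has room for `k + 1` limits exactly because `k < K`. -/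

/-! ### Lattice properties and first estimates of the norm -/

theorem normStep_mono_abs (k d : ℕ) {θ : ℝ} (h0 : 0 < θ) (h1 : θ < 1) (j : ℕ) :
    ∀ x y : Omega k →₀ ℝ, (∀ v, |x v| ≤ |y v|) → normStep k d θ j x ≤ normStep k d θ j y := by
  induction j with
  | zero => exact fun x y h => ciSup_mono (bddAbove_abs y) h
  | succ j ih =>
    intro x y h
    refine max_le_max (ih x y h) (mul_le_mul_of_nonneg_left ?_ h0.le)
    refine Real.sSup_le ?_ (Real.sSup_nonneg ?_)
    · rintro _ ⟨m, E, hE, rfl⟩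
      refine le_trans ?_ (le_csSup (bddAbove_sums k d h0 h1 j y) ⟨m, E, hE, rfl⟩)
      refine Finset.sum_le_sum fun i _ => ih _ _ fun v => ?_
      rw [restrict_apply, restrict_apply]
      split_ifs
      · exact h v
      · exact le_rfl
    · rintro _ ⟨m, E, _, rfl⟩
      exact Finset.sum_nonneg fun i _ => normStep_nonneg k d θ j _

/-- The unit vector basis is `1`-unconditional. -/
theorem tsirelsonNorm_mono_abs {k d : ℕ} {θ : ℝ} (h0 : 0 < θ) (h1 : θ < 1) {x y : Omega k →₀ ℝ}
    (h : ∀ v, |x v| ≤ |y v|) : tsirelsonNorm k d θ x ≤ tsirelsonNorm k d θ y :=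
  ciSup_mono (bddAbove_normStep k d h0 h1 y) fun j => normStep_mono_abs k d h0 h1 j x y h

theorem tsirelsonNorm_filter_le {k d : ℕ} {θ : ℝ} (h0 : 0 < θ) (h1 : θ < 1) (x : Omega k →₀ ℝ)
    (p : Omega k → Prop) [DecidablePred p] :
    tsirelsonNorm k d θ (x.filter p) ≤ tsirelsonNorm k d θ x := by
  refine tsirelsonNorm_mono_abs h0 h1 fun v => ?_
  rw [Finsupp.filter_apply]
  split_ifs
  · exact le_rfl
  · simp

theorem tsirelsonNorm_add_le {k d : ℕ} {θ : ℝ} (h0 : 0 < θ) (h1 : θ < 1) (x y : Omega k →₀ ℝ) :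
    tsirelsonNorm k d θ (x + y) ≤ tsirelsonNorm k d θ x + tsirelsonNorm k d θ y :=
  ciSup_le fun j => (normStep_add_le k d h0 h1 j x y).trans
    (add_le_add (le_ciSup (bddAbove_normStep k d h0 h1 x) j)
      (le_ciSup (bddAbove_normStep k d h0 h1 y) j))

theorem tsirelsonNorm_nonneg (k d : ℕ) (θ : ℝ) (x : Omega k →₀ ℝ) :
    0 ≤ tsirelsonNorm k d θ x :=
  Real.iSup_nonneg fun j => normStep_nonneg k d θ j x

theorem tsirelsonNorm_le_l1Norm {k d : ℕ} {θ : ℝ} (h0 : 0 < θ) (h1 : θ < 1) (x : Omega k →₀ ℝ) :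
    tsirelsonNorm k d θ x ≤ l1Norm x :=
  ciSup_le fun j => normStep_le_l1Norm k d h0 h1 j x

theorem tsirelsonNorm_zero {k d : ℕ} {θ : ℝ} (h0 : 0 < θ) (h1 : θ < 1) :
    tsirelsonNorm k d θ 0 = 0 :=
  le_antisymm ((tsirelsonNorm_le_l1Norm h0 h1 0).trans (by simp [l1Norm]))
    (tsirelsonNorm_nonneg k d θ 0)

theorem tsirelsonNorm_sum_le {k d : ℕ} {θ : ℝ} (h0 : 0 < θ) (h1 : θ < 1) {ι : Type*}
    (s : Finset ι) (x : ι → Omega k →₀ ℝ) :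
    tsirelsonNorm k d θ (∑ i ∈ s, x i) ≤ ∑ i ∈ s, tsirelsonNorm k d θ (x i) :=
  Finset.le_sum_of_subadditive _ (tsirelsonNorm_zero h0 h1).le (tsirelsonNorm_add_le h0 h1) s x

theorem abs_le_tsirelsonNorm {k d : ℕ} {θ : ℝ} (h0 : 0 < θ) (h1 : θ < 1) (x : Omega k →₀ ℝ)
    (v : Omega k) : |x v| ≤ tsirelsonNorm k d θ x :=
  (le_ciSup (bddAbove_abs x) v).trans (le_ciSup (bddAbove_normStep k d h0 h1 x) 0)

theorem tsirelsonNorm_neg {k d : ℕ} {θ : ℝ} (h0 : 0 < θ) (h1 : θ < 1) (x : Omega k →₀ ℝ) :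
    tsirelsonNorm k d θ (-x) = tsirelsonNorm k d θ x :=
  le_antisymm (tsirelsonNorm_mono_abs h0 h1 fun v => by simp)
    (tsirelsonNorm_mono_abs h0 h1 fun v => by simp)

theorem normStep_monotone (k d : ℕ) (θ : ℝ) (x : Omega k →₀ ℝ) :
    Monotone fun j => normStep k d θ j x :=
  monotone_nat_of_le_succ fun _ => le_max_left _ _

theorem tendsto_normStep (k d : ℕ) {θ : ℝ} (h0 : 0 < θ) (h1 : θ < 1) (x : Omega k →₀ ℝ) :
    Filter.Tendsto (fun j => normStep k d θ j x) Filter.atTop (nhds (tsirelsonNorm k d θ x)) :=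
  tendsto_atTop_ciSup (normStep_monotone k d θ x) (bddAbove_normStep k d h0 h1 x)

/-- The inequality between stages `j` and `j + 1` survives the limit, as each stage norm increases
to its supremum. This is the only source of lower estimates besides the coordinates. -/
theorem mul_sum_le_tsirelsonNorm {k d m : ℕ} {θ : ℝ} (h0 : 0 < θ) (h1 : θ < 1)
    {E : Fin m → Finset (Omega k)} (hE : Admissible k d E) (x : Omega k →₀ ℝ) :
    θ * ∑ i, tsirelsonNorm k d θ (restrict (E i) x) ≤ tsirelsonNorm k d θ x := by
  have h : Filter.Tendsto (fun j => θ * ∑ i, normStep k d θ j (restrict (E i) x)) Filter.atTop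
      (nhds (θ * ∑ i, tsirelsonNorm k d θ (restrict (E i) x))) :=
    (tendsto_finsetSum _ fun i _ => tendsto_normStep k d h0 h1 _).const_mul θ
  refine le_of_tendsto' h fun j => ?_
  refine le_trans ?_ (le_ciSup (bddAbove_normStep k d h0 h1 x) (j + 1))
  refine le_trans ?_ (le_max_right _ _)
  exact mul_le_mul_of_nonneg_left (le_csSup (bddAbove_sums k d h0 h1 j x) ⟨m, E, hE, rfl⟩) h0.le

/-- The norm is `o(N)` on sums of `N` unit vectors. -/
theorem exists_normStep_le (k d : ℕ) {θ : ℝ} (h0 : 0 < θ) (h1 : θ < 1) (j : ℕ) :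
    ∃ B : ℝ, 0 ≤ B ∧ ∀ n, ∀ (x : Omega k →₀ ℝ) (b : ℝ), 0 ≤ b → (∀ v, |x v| ≤ b) →
      normStep k d θ n x ≤ θ ^ j * l1Norm x + B * b := by
  induction j with
  | zero =>
    exact ⟨0, le_rfl, fun n x b _ _ => by simpa using normStep_le_l1Norm k d h0 h1 n x⟩
  | succ j ih =>
    obtain ⟨B, hB, ih⟩ := ih
    have hdB : 0 ≤ θ * d * B := by positivity
    -- The `1` pays for the sup norm. Each of the at most `d` pieces costs `B * b`, and the factor
    -- `θ` turns `θ ^ j` into `θ ^ (j + 1)`.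
    refine ⟨1 + θ * d * B, by positivity, fun n => ?_⟩
    induction n with
    | zero =>
      intro x b hb hx
      have h2 : 0 ≤ θ ^ (j + 1) * l1Norm x := mul_nonneg (by positivity) (l1Norm_nonneg x)
      refine Real.iSup_le (fun v => (hx v).trans ?_) (by positivity)
      nlinarith [mul_nonneg hdB hb]
    | succ n ihn =>
      intro x b hb hx
      refine max_le (ihn x b hb hx) ?_
      have h2 : sSup {r | ∃ (m : ℕ) (E : Fin m → Finset (Omega k)), Admissible k d E ∧
          r = ∑ i, normStep k d θ n (restrict (E i) x)} ≤ θ ^ j * l1Norm x + d * (B * b) := by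
        have h3 : 0 ≤ θ ^ j * l1Norm x := mul_nonneg (by positivity) (l1Norm_nonneg x)
        refine Real.sSup_le ?_ (by positivity)
        rintro _ ⟨m, E, hE, rfl⟩
        calc ∑ i, normStep k d θ n (restrict (E i) x)
            ≤ ∑ i, (θ ^ j * l1Norm (restrict (E i) x) + B * b) := by
              refine Finset.sum_le_sum fun i _ => ih n _ b hb fun v => ?_
              rw [restrict_apply]
              split_ifs
              · exact hx v
              · simpa using hb
          _ = θ ^ j * ∑ i, l1Norm (restrict (E i) x) + m * (B * b) := by
              rw [Finset.sum_add_distrib, Finset.mul_sum]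
              simp
          _ ≤ θ ^ j * l1Norm x + d * (B * b) := by
              refine add_le_add (mul_le_mul_of_nonneg_left (sum_l1Norm_restrict_le hE x)
                (by positivity)) (mul_le_mul_of_nonneg_right ?_ (mul_nonneg hB hb))
              exact_mod_cast hE.2.1
      calc _ ≤ θ * (θ ^ j * l1Norm x + d * (B * b)) := mul_le_mul_of_nonneg_left h2 h0.le
        _ ≤ _ := by
          rw [pow_succ]
          nlinarith

theorem exists_tsirelsonNorm_le (k d : ℕ) {θ : ℝ} (h0 : 0 < θ) (h1 : θ < 1) (j : ℕ) :
    ∃ B : ℝ, 0 ≤ B ∧ ∀ x : Omega k →₀ ℝ, (∀ v, |x v| ≤ 1) →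
      tsirelsonNorm k d θ x ≤ θ ^ j * l1Norm x + B := by
  obtain ⟨B, hB, h⟩ := exists_normStep_le k d h0 h1 j
  exact ⟨B, hB, fun x hx => ciSup_le fun n => by simpa using h n x 1 zero_le_one hx⟩

/-! ### The order `≺`, rows and ranks -/

/-- The last term of a sequence. -/
def top (s : List ℕ) : ℕ := s.getLastD 0

theorem top_eq_getLast {s : List ℕ} (h : s ≠ []) : top s = s.getLast h := by
  cases s
  · exact absurd rfl h
  · rw [top, List.getLastD_cons, List.getLast_eq_getLastD]

theorem top_eq_getElem {s : List ℕ} (h : s.length - 1 < s.length) : top s = s[s.length - 1] := by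
  rw [top_eq_getLast (by rintro rfl; simp at h), List.getLast_eq_getElem]

theorem top_mem {s : List ℕ} (h : s ≠ []) : top s ∈ s := by
  rw [top_eq_getLast h]
  exact List.getLast_mem h

theorem le_top {s : List ℕ} (hs : s.Pairwise (· ≤ ·)) {x : ℕ} (hx : x ∈ s) : x ≤ top s := by
  obtain ⟨i, hi, rfl⟩ := List.getElem_of_mem hx
  rw [top_eq_getElem (by omega)]
  rcases (show i ≤ s.length - 1 by omega).eq_or_lt with h | h
  · simp [h]
  · exact List.pairwise_iff_getElem.1 hs _ _ _ _ h

theorem prec_iff {s t : List ℕ} (hs : s ≠ []) (ht : t ≠ []) :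
    Prec s t ↔ top s < top t ∨ (top s = top t ∧ s < t) := by
  rw [top_eq_getLast hs, top_eq_getLast ht]
  constructor
  · rintro (⟨h, _⟩ | ⟨_, _, h⟩)
    · exact absurd h hs
    · exact h
  · exact fun h => Or.inr ⟨hs, ht, h⟩

theorem not_prec_nil (s : List ℕ) : ¬ Prec s [] := by
  rintro (⟨_, h⟩ | ⟨_, h, _⟩) <;> exact h rfl

theorem nil_prec {t : List ℕ} (ht : t ≠ []) : Prec [] t := Or.inl ⟨rfl, ht⟩

theorem Prec.ne_nil {s t : List ℕ} (h : Prec s t) : t ≠ [] := by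
  rintro rfl
  exact not_prec_nil s h

theorem prec_of_top_lt {s t : List ℕ} (h : top s < top t) : Prec s t := by
  have ht : t ≠ [] := by
    rintro rfl
    simp [top] at h
  by_cases hs : s = []
  · rw [hs]
    exact nil_prec ht
  · exact (prec_iff hs ht).2 (Or.inl h)

theorem Prec.top_le {s t : List ℕ} (h : Prec s t) : top s ≤ top t := by
  by_cases hs : s = []
  · simp [hs, top]
  · rcases (prec_iff hs h.ne_nil).1 h with h | h
    · exact h.le
    · exact h.1.le

theorem prec_trichotomy (s t : List ℕ) : s = t ∨ Prec s t ∨ Prec t s := by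
  by_cases hs : s = [] <;> by_cases ht : t = []
  · exact Or.inl (hs.trans ht.symm)
  · exact Or.inr (Or.inl (hs ▸ nil_prec ht))
  · exact Or.inr (Or.inr (ht ▸ nil_prec hs))
  · rw [prec_iff hs ht, prec_iff ht hs]
    rcases lt_trichotomy (top s) (top t) with h | h | h
    · exact Or.inr (Or.inl (Or.inl h))
    · rcases lt_trichotomy s t with h' | h' | h'
      · exact Or.inr (Or.inl (Or.inr ⟨h, h'⟩))
      · exact Or.inl h'
      · exact Or.inr (Or.inr (Or.inr ⟨h.symm, h'⟩))
    · exact Or.inr (Or.inr (Or.inl h))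

theorem Prec.trans {s t u : List ℕ} (h : Prec s t) (h' : Prec t u) : Prec s u := by
  by_cases hs : s = []
  · exact hs ▸ nil_prec h'.ne_nil
  · have ht := h.ne_nil
    have hu := h'.ne_nil
    rw [prec_iff hs ht] at h
    rw [prec_iff ht hu] at h'
    rw [prec_iff hs hu]
    rcases h with h | ⟨h1, h2⟩ <;> rcases h' with h' | ⟨h3, h4⟩
    · exact Or.inl (h.trans h')
    · exact Or.inl (h3 ▸ h)
    · exact Or.inl (h1 ▸ h')
    · exact Or.inr ⟨h1.trans h3, h2.trans h4⟩

theorem ProperInit.lt {s t : List ℕ} (h : ProperInit s t) : s < t := by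
  obtain ⟨⟨u, rfl⟩, h2⟩ := h
  rw [List.lt_iff_exists]
  left
  have : u ≠ [] := by
    rintro rfl
    simp at h2
  simp [List.length_pos_iff.2 this]

theorem ProperInit.length_lt {s t : List ℕ} (h : ProperInit s t) : s.length < t.length :=
  lt_of_le_of_ne h.1.length_le fun h' => h.2 (h.1.eq_of_length h')

theorem properInit_of_prefix {s t : List ℕ} (h : s <+: t) (h' : s.length < t.length) :
    ProperInit s t :=
  ⟨h, by rintro rfl; exact lt_irrefl _ h'⟩

theorem ProperInit.prec {s t : List ℕ} (h : ProperInit s t) (ht : t.Pairwise (· ≤ ·)) :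
    Prec s t := by
  have ht0 : t ≠ [] := by
    rintro rfl
    simpa using h.length_lt
  by_cases hs : s = []
  · exact hs ▸ nil_prec ht0
  · rw [prec_iff hs ht0]
    rcases (le_top ht (h.1.subset (top_mem hs))).lt_or_eq with h' | h'
    · exact Or.inl h'
    · exact Or.inr ⟨h', h.lt⟩

theorem finite_lists_le (k n : ℕ) : {s : List ℕ | s.length ≤ k ∧ ∀ x ∈ s, x ≤ n}.Finite := by
  refine ((List.finite_length_le (Fin (n + 1)) k).image (List.map Fin.val)).subset ?_
  rintro s ⟨h1, h2⟩
  refine ⟨s.pmap (fun x hx => ⟨x, hx⟩) (fun x hx => Nat.lt_succ_of_le (h2 x hx)),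
    by simpa using h1, ?_⟩
  rw [List.map_pmap]
  simp

/-- The last term bounds all others, so only finitely many sequences end at or below a given row.
Hence every sequence has finitely many `≺`-predecessors and `OmegaLE.rank` is meaningful. -/
theorem OmegaLE.finite_top_le (k n : ℕ) : {s : OmegaLE k | top s.1 ≤ n}.Finite := by
  refine ((finite_lists_le k n).preimage (f := Subtype.val) Subtype.val_injective.injOn).subset ?_
  exact fun s hs => ⟨s.2.1, fun x hx => (le_top s.2.2 hx).trans hs⟩

theorem Omega.toLE_injective (k : ℕ) : Function.Injective (Omega.toLE (k := k)) :=
  fun _ _ h => Subtype.ext (congrArg (fun s : OmegaLE k => s.1) h)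

theorem Omega.finite_top_le (k n : ℕ) : {s : Omega k | top s.1 ≤ n}.Finite :=
  (OmegaLE.finite_top_le k n).preimage (f := Omega.toLE) (Omega.toLE_injective k).injOn

/-- The number of `≺`-predecessors of a sequence. -/
noncomputable def OmegaLE.rank {k : ℕ} (s : OmegaLE k) : ℕ :=
  Set.ncard {t : OmegaLE k | Prec t.1 s.1}

theorem OmegaLE.rank_lt {k : ℕ} {s t : OmegaLE k} (h : Prec s.1 t.1) : s.rank < t.rank := by
  refine Set.ncard_lt_ncard ?_ ((OmegaLE.finite_top_le k (top t.1)).subset fun u hu => hu.top_le)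
  refine ⟨fun u hu => Prec.trans hu h, fun hs => ?_⟩
  exact Prec.irrefl s.1 (hs h)

theorem OmegaLE.rank_injective (k : ℕ) : Function.Injective (OmegaLE.rank (k := k)) := by
  intro s t h
  rcases prec_trichotomy s.1 t.1 with h' | h' | h'
  · exact Subtype.ext h'
  · exact absurd h (OmegaLE.rank_lt h').ne
  · exact absurd h (OmegaLE.rank_lt h').ne'

/-! ### Trees preserve levels -/

theorem IsEllentuckTree.le_length {k : ℕ} {f : OmegaLE k → OmegaLE k} (hf : IsEllentuckTree k f) :
    ∀ (n : ℕ) (s : OmegaLE k), n ≤ s.1.length → n ≤ (f s).1.length := by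
  intro n
  induction n with
  | zero => exact fun _ _ => Nat.zero_le _
  | succ n ih =>
    intro s hs
    let t : OmegaLE k := ⟨s.1.take n, (List.length_take_le' _ _).trans s.2.1,
      s.2.2.sublist (List.take_sublist _ _)⟩
    have ht : t.1.length = n := by simp [t]; omega
    have h1 := (hf.2 t s (properInit_of_prefix (List.take_prefix _ _) (by omega))).length_lt
    have h2 := ih t ht.ge
    omega

/-- Repeating the last term extends `s` up to length `k`. Each added term lengthens the image, which
cannot exceed length `k`. -/
theorem IsEllentuckTree.length_le {k : ℕ} {f : OmegaLE k → OmegaLE k} (hf : IsEllentuckTree k f) :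
    ∀ (n : ℕ) (s : OmegaLE k), s.1.length + n = k → (f s).1.length ≤ s.1.length := by
  intro n
  induction n with
  | zero =>
    intro s hs
    have := (f s).2.1
    omega
  | succ n ih =>
    intro s hs
    let t : OmegaLE k := ⟨s.1 ++ [top s.1], by simp; omega, by
      rw [List.pairwise_append]
      refine ⟨s.2.2, List.pairwise_singleton _ _, fun a ha b hb => ?_⟩
      rw [List.mem_singleton.1 hb]
      exact le_top s.2.2 ha⟩
    have ht : t.1.length = s.1.length + 1 := by simp [t]
    have h1 := (hf.2 s t (properInit_of_prefix (List.prefix_append _ _) (by omega))).length_lt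
    have h2 := ih t (by omega)
    omega

theorem IsEllentuckTree.length_eq {k : ℕ} {f : OmegaLE k → OmegaLE k} (hf : IsEllentuckTree k f)
    (s : OmegaLE k) : (f s).1.length = s.1.length :=
  le_antisymm (hf.length_le (k - s.1.length) s (by have := s.2.1; omega)) (hf.le_length _ s le_rfl)

theorem IsEllentuckTree.injective {k : ℕ} {f : OmegaLE k → OmegaLE k} (hf : IsEllentuckTree k f) :
    Function.Injective f := by
  intro s t h
  rcases prec_trichotomy s.1 t.1 with h' | h' | h'
  · exact Subtype.ext h'
  · exact absurd (h ▸ hf.1 s t h') (Prec.irrefl _)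
  · exact absurd (h ▸ hf.1 t s h') (Prec.irrefl _)

theorem IsEllentuckTree.prec_of_prec {k : ℕ} {f : OmegaLE k → OmegaLE k}
    (hf : IsEllentuckTree k f) {s t : OmegaLE k} (h : Prec (f s).1 (f t).1) : Prec s.1 t.1 := by
  rcases prec_trichotomy s.1 t.1 with h' | h' | h'
  · rw [Subtype.ext h'] at h
    exact absurd h (Prec.irrefl _)
  · exact h'
  · exact absurd (hf.1 t s h') h.asymm

/-- The initial segment of length at most `n`. -/
def OmegaLE.take {k : ℕ} (s : OmegaLE k) (n : ℕ) : OmegaLE k :=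
  ⟨s.1.take n, (List.length_take_le' _ _).trans s.2.1, s.2.2.sublist (List.take_sublist _ _)⟩

theorem IsEllentuckTree.take {k : ℕ} {f : OmegaLE k → OmegaLE k} (hf : IsEllentuckTree k f)
    (s : OmegaLE k) (n : ℕ) : f (s.take n) = (f s).take n := by
  by_cases hn : n < s.1.length
  · have ht : (s.take n).1.length = n := by simp [OmegaLE.take]; omega
    have h1 := (hf.2 (s.take n) s (properInit_of_prefix (List.take_prefix _ _) (by omega))).1
    rw [List.prefix_iff_eq_take, hf.length_eq, ht] at h1
    exact Subtype.ext h1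
  · have h1 : s.take n = s := Subtype.ext (List.take_of_length_le (by omega))
    have h2 : (f s).take n = f s := Subtype.ext (List.take_of_length_le (by
      rw [hf.length_eq]; omega))
    rw [h1, h2]

/-- The map induced on the sequences of length `k`. -/
def treeMap {k : ℕ} {f : OmegaLE k → OmegaLE k} (hf : IsEllentuckTree k f) (u : Omega k) :
    Omega k :=
  ⟨(f u.toLE).1, (hf.length_eq _).trans u.2.1, (f u.toLE).2.2⟩

theorem treeMap_injective {k : ℕ} {f : OmegaLE k → OmegaLE k} (hf : IsEllentuckTree k f) :
    Function.Injective (treeMap hf) := by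
  intro u v h
  apply Omega.toLE_injective
  apply hf.injective
  exact Subtype.ext (congrArg (fun s : Omega k => s.1) h)

theorem mem_approxOfSize {k : ℕ} {f : OmegaLE k → OmegaLE k} (hf : IsEllentuckTree k f)
    {F : Finset (Omega k)} (h1 : ∀ v ∈ F, ∃ u, treeMap hf u = v)
    (h2 : ∀ v ∈ F, ∀ u, Prec (treeMap hf u).1 v.1 → treeMap hf u ∈ F) :
    F ∈ approxOfSize k F.card := by
  refine ⟨_, ⟨f, hf, rfl⟩, rfl, fun v hv => ?_, ?_⟩
  · obtain ⟨u, rfl⟩ := h1 v hv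
    exact ⟨u, rfl⟩
  · rintro v hv w ⟨u, hu⟩ hw
    obtain rfl : treeMap hf u = w := Subtype.ext hu
    exact h2 v hv u hw

/-- The constant sequence with value `n`. -/
def Omega.const (k n : ℕ) : Omega k := ⟨List.replicate k n, by simp, by
  rw [List.pairwise_replicate]; right; exact le_rfl⟩

theorem top_const {k : ℕ} (hk : 0 < k) (n : ℕ) : top (Omega.const k n).1 = n := by
  rw [top_eq_getElem (by simp [Omega.const]; omega)]
  simp [Omega.const]

theorem Omega.ne_nil {k : ℕ} (hk : 0 < k) (v : Omega k) : v.1 ≠ [] := by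
  intro h
  have := v.2.1
  rw [h] at this
  simp at this
  omega

theorem const_zero_prec {k : ℕ} (u : Omega k) : u = Omega.const k 0 ∨
    Prec (Omega.const k 0).1 u.1 := by
  rcases prec_trichotomy u.1 (Omega.const k 0).1 with h | h | h
  · exact Or.inl (Subtype.ext h)
  · exfalso
    rcases Nat.eq_zero_or_pos k with rfl | hk
    · exact h.ne_nil (by simp [Omega.const])
    · have h1 := h.top_le
      rw [top_const hk] at h1
      have h2 : u.1 = (Omega.const k 0).1 := by
        refine List.eq_replicate_iff.2 ⟨u.2.1, fun b hb => ?_⟩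
        have := le_top u.2.2 hb
        omega
      rw [h2] at h
      exact Prec.irrefl _ h
  · exact Or.inr h

/-! ### Shifted and stretched trees -/

/-- Termwise, send `0` to the corresponding term of `P` and `x > 0` to `M + x`. -/
def shiftList (P : List ℕ) (M : ℕ) (s : List ℕ) : List ℕ :=
  List.zipWith (fun a x => if x = 0 then a else M + x) P s

theorem length_shiftList {P s : List ℕ} (M : ℕ) (h : s.length ≤ P.length) :
    (shiftList P M s).length = s.length := by
  simp [shiftList, h]

theorem getElem_shiftList {P s : List ℕ} {M i : ℕ} (h : i < (shiftList P M s).length)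
    (h1 : i < P.length) (h2 : i < s.length) :
    (shiftList P M s)[i] = if s[i] = 0 then P[i] else M + s[i] := by
  simp [shiftList]

theorem shiftList_prefix {P s t : List ℕ} (M : ℕ) (ht : t.length ≤ P.length) (h : s <+: t) :
    shiftList P M s <+: shiftList P M t := by
  have hl := h.length_le
  rw [List.prefix_iff_getElem] at h ⊢
  obtain ⟨_, h⟩ := h
  have h1 := length_shiftList M ht
  have h2 := length_shiftList M (hl.trans ht)
  refine ⟨by omega, fun i hi => ?_⟩
  rw [getElem_shiftList _ (by omega) (by omega), getElem_shiftList _ (by omega) (by omega),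
    h i (by omega)]

theorem shiftList_lt {P s t : List ℕ} {M : ℕ} (hP : ∀ x ∈ P, x ≤ M) (hs : s.length ≤ P.length)
    (ht : t.length ≤ P.length) (h : s < t) : shiftList P M s < shiftList P M t := by
  have h1 := length_shiftList M ht
  have h2 := length_shiftList M hs
  rw [List.lt_iff_exists] at h
  rcases h with ⟨h, h'⟩ | ⟨i, hi, hi', h, h'⟩
  · exact (properInit_of_prefix (shiftList_prefix M ht (List.prefix_iff_eq_take.2 h))
      (by omega)).lt
  · rw [List.lt_iff_exists]
    right
    refine ⟨i, by omega, by omega, fun j hj => ?_, ?_⟩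
    · rw [getElem_shiftList _ (by omega) (by omega), getElem_shiftList _ (by omega) (by omega),
        h j hj]
    · rw [getElem_shiftList _ (by omega) (by omega), getElem_shiftList _ (by omega) (by omega)]
      have := hP P[i] (List.getElem_mem (by omega))
      split_ifs <;> omega

theorem shiftList_pairwise {P s : List ℕ} {M : ℕ} (hP : ∀ x ∈ P, x ≤ M)
    (hP' : P.Pairwise (· ≤ ·)) (hl : s.length ≤ P.length) (hs : s.Pairwise (· ≤ ·)) :
    (shiftList P M s).Pairwise (· ≤ ·) := by
  have h2 := length_shiftList M hl
  rw [List.pairwise_iff_getElem] at hs hP' ⊢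
  intro i j hi hj hij
  rw [getElem_shiftList _ (by omega) (by omega), getElem_shiftList _ (by omega) (by omega)]
  have h3 := hP P[i] (List.getElem_mem (by omega))
  have h4 := hs i j (by omega) (by omega) hij
  have h5 := hP' i j (by omega) (by omega) hij
  split_ifs <;> omega

theorem shiftList_prec {P s t : List ℕ} {M : ℕ} (hP : ∀ x ∈ P, x ≤ M)
    (hP' : P.Pairwise (· ≤ ·)) (hs : s.length ≤ P.length) (ht : t.length ≤ P.length)
    (hts : t.Pairwise (· ≤ ·)) (h : Prec s t) : Prec (shiftList P M s) (shiftList P M t) := by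
  have h1 := length_shiftList M ht
  have h2 := length_shiftList M hs
  have hlt := List.length_pos_iff.2 h.ne_nil
  have ht' : shiftList P M t ≠ [] := List.length_pos_iff.1 (by omega)
  by_cases hs0 : s = []
  · subst hs0
    rw [List.length_eq_zero_iff.1 (h2.trans rfl)]
    exact nil_prec ht'
  have hls := List.length_pos_iff.2 hs0
  have hs' : shiftList P M s ≠ [] := List.length_pos_iff.1 (by omega)
  have e1 : top (shiftList P M s) = if top s = 0 then P[s.length - 1] else M + top s := by
    rw [top_eq_getElem (by omega), getElem_shiftList _ (by omega) (by omega),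
      top_eq_getElem (by omega)]
    simp only [h2]
  have e2 : top (shiftList P M t) = if top t = 0 then P[t.length - 1] else M + top t := by
    rw [top_eq_getElem (by omega), getElem_shiftList _ (by omega) (by omega),
      top_eq_getElem (by omega)]
    simp only [h1]
  have h3 := hP P[s.length - 1] (List.getElem_mem (by omega))
  rcases (prec_iff hs0 h.ne_nil).1 h with h | ⟨h, h'⟩
  · apply prec_of_top_lt
    rw [e1, e2]
    split_ifs <;> omega
  · rw [prec_iff hs' ht']
    have h4 := shiftList_lt hP hs ht h'
    suffices top (shiftList P M s) ≤ top (shiftList P M t) from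
      this.lt_or_eq.imp_right fun h => ⟨h, h4⟩
    -- Only a common last term `0` needs thought: then both sequences consist of zeros, so `s < t`
    -- means that `s` is shorter, and `P` is non-decreasing.
    rw [e1, e2, h]
    split_ifs with h0
    · rw [List.lt_iff_exists] at h'
      rcases h' with ⟨_, h'⟩ | ⟨i, hi, hi', _, h'⟩
      · exact List.pairwise_iff_getElem.1 hP' _ _ _ _ (by omega)
      · have := le_top hts (List.getElem_mem hi')
        omega
    · exact le_rfl

theorem exists_shift_tree {k : ℕ} (P : Omega k) {M : ℕ} (hP : ∀ x ∈ P.1, x ≤ M) :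
    ∃ f : OmegaLE k → OmegaLE k, IsEllentuckTree k f ∧ ∀ s, (f s).1 = shiftList P.1 M s.1 := by
  have hl : ∀ s : OmegaLE k, s.1.length ≤ P.1.length := fun s => s.2.1.trans P.2.1.ge
  refine ⟨fun s => ⟨shiftList P.1 M s.1, (length_shiftList M (hl s)).le.trans s.2.1,
    shiftList_pairwise hP P.2.2 (hl s) s.2.2⟩, ⟨fun s t h => ?_, fun s t h => ?_⟩, fun s => rfl⟩
  · exact shiftList_prec hP P.2.2 (hl s) (hl t) t.2.2 h
  · refine properInit_of_prefix (shiftList_prefix M (hl t) h.1) ?_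
    rw [length_shiftList M (hl s), length_shiftList M (hl t)]
    exact h.length_lt

/-- A member of `𝒜ℛ^k` between two given rows that contains the full part, between these rows, of
the tree above `p`. -/
theorem exists_approx_above {k M R : ℕ} {p : List ℕ} (hp : p.Pairwise (· ≤ ·))
    (hpk : p.length < k) (hpM : ∀ x ∈ p, x ≤ M) (hMR : M ≤ R) :
    ∃ F ∈ approx k, (∀ v : Omega k, p <+: v.1 → (∀ x ∈ v.1.drop p.length, M ≤ x ∧ x ≤ R) →
      v ∈ F) ∧ ∀ v ∈ F, M ≤ top v.1 ∧ top v.1 ≤ R := by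
  classical
  have hk : 0 < k := by omega
  -- `P` is to be the first member of the tree: it extends `p` and ends in row `M`.
  let P : Omega k := ⟨p ++ List.replicate (k - p.length) M, by simp; omega, by
    rw [List.pairwise_append]
    refine ⟨hp, by rw [List.pairwise_replicate]; right; exact le_rfl, fun a ha b hb => ?_⟩
    rw [List.eq_of_mem_replicate hb]
    exact hpM a ha⟩
  have hP : ∀ x ∈ P.1, x ≤ M := by
    intro x hx
    rcases List.mem_append.1 hx with h | h
    · exact hpM x h
    · exact (List.eq_of_mem_replicate h).le
  have hPt : top P.1 = M := by
    refine le_antisymm (hP _ (top_mem (P.ne_nil hk))) (le_top P.2.2 ?_)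
    refine List.mem_append_right _ ?_
    rw [List.mem_replicate]
    exact ⟨by omega, rfl⟩
  obtain ⟨f, hf, hfs⟩ := exists_shift_tree P hP
  have hT : ∀ u, (treeMap hf u).1 = shiftList P.1 M u.1 := fun u => hfs u.toLE
  have hl : ∀ u : Omega k, u.1.length ≤ P.1.length := fun u => (u.2.1.trans P.2.1.symm).le
  have h0 : treeMap hf (Omega.const k 0) = P := by
    apply Subtype.ext
    rw [hT]
    refine List.ext_getElem ((length_shiftList M (hl _)).trans
      ((Omega.const k 0).2.1.trans P.2.1.symm)) fun i hi hi' => ?_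
    rw [getElem_shiftList _ hi' (by rw [length_shiftList M (hl _)] at hi; exact hi)]
    simp [Omega.const]
  have hrow : ∀ u, M ≤ top (treeMap hf u).1 := by
    intro u
    rcases const_zero_prec u with h | h
    · rw [h, h0, hPt]
    · have := (hf.1 (Omega.const k 0).toLE u.toLE h).top_le
      change top (treeMap hf (Omega.const k 0)).1 ≤ _ at this
      rw [h0, hPt] at this
      exact this
  -- The approximation consists of all members of the tree up to row `R`. It is an initial part
  -- because `≺` compares rows first.
  have hfin : {v : Omega k | (∃ u, treeMap hf u = v) ∧ top v.1 ≤ R}.Finite :=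
    (Omega.finite_top_le k R).subset fun v hv => hv.2
  have hmem : ∀ v, v ∈ hfin.toFinset ↔ (∃ u, treeMap hf u = v) ∧ top v.1 ≤ R := fun v => by simp
  refine ⟨hfin.toFinset, ⟨_, ?_, mem_approxOfSize hf (fun v hv => ((hmem v).1 hv).1) ?_⟩, ?_, ?_⟩
  · refine Finset.card_pos.2 ⟨P, (hmem P).2 ⟨⟨_, h0⟩, ?_⟩⟩
    rw [hPt]
    exact hMR
  · intro v hv u hu
    exact (hmem _).2 ⟨⟨u, rfl⟩, hu.top_le.trans ((hmem v).1 hv).2⟩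
  · rintro v ⟨w, hw⟩ hv
    rw [← hw, List.drop_left] at hv
    have hlen : p.length + w.length = k := by rw [← v.2.1, ← hw, List.length_append]
    -- The preimage of `v`: zeros reproduce `p`. Beyond `p`, a term `M` comes from `0`, where `P`
    -- has the value `M`, and a term above `M` is shifted back.
    let u : Omega k := ⟨List.replicate p.length 0 ++ w.map (· - M), by simp [hlen], by
      rw [List.pairwise_append]
      refine ⟨by rw [List.pairwise_replicate]; right; exact le_rfl, ?_, fun a ha b _ => ?_⟩
      · rw [List.pairwise_map]
        have := v.2.2
        rw [← hw, List.pairwise_append] at this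
        exact this.2.1.imp fun h => Nat.sub_le_sub_right h M
      · rw [List.eq_of_mem_replicate ha]
        exact Nat.zero_le _⟩
    rw [hmem]
    refine ⟨⟨u, Subtype.ext ?_⟩, ?_⟩
    · rw [hT, ← hw]
      refine List.ext_getElem ((length_shiftList M (hl _)).trans (by
        rw [u.2.1, List.length_append, hlen])) fun i hi hi' => ?_
      have hi1 : i < k := by
        rw [length_shiftList M (hl _), u.2.1] at hi
        exact hi
      rw [getElem_shiftList _ (by rw [P.2.1]; exact hi1) (by rw [u.2.1]; exact hi1)]
      by_cases hip : i < p.length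
      · simp [u, P, hip]
      · have := (hv w[i - p.length] (List.getElem_mem _)).1
        simp only [u, P, List.getElem_append, hip, List.length_replicate, dite_false,
          List.getElem_map, List.getElem_replicate]
        split_ifs <;> omega
    · have h1 : w ≠ [] := by
        rintro rfl
        simp at hlen
        omega
      have : top v.1 = top w := by
        rw [top_eq_getLast (v.ne_nil hk), top_eq_getLast h1]
        simp only [← hw]
        exact List.getLast_append_of_ne_nil _ h1
      rw [this]
      exact (hv _ (top_mem h1)).2
  · intro v hv
    obtain ⟨⟨u, rfl⟩, h⟩ := (hmem v).1 hv
    exact ⟨hrow u, h⟩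

/-- The sequence of the values of `H` at the nonempty initial segments of `s`. -/
def stretchList {k : ℕ} (H : OmegaLE k → ℕ) (s : OmegaLE k) : List ℕ :=
  List.ofFn fun i : Fin s.1.length => H (s.take (i + 1))

/-- The image of a nonempty `s` ends in `H s`, so monotonicity of `H` alone gives `≺`. The `i`-th
term depends only on the initial segment up to there, which gives `⊏`. -/
theorem exists_stretch_tree {k : ℕ} (hk : 0 < k) (H : OmegaLE k → ℕ)
    (hH : ∀ s t, Prec s.1 t.1 → H s < H t) :
    ∃ f : OmegaLE k → OmegaLE k, ∃ hf : IsEllentuckTree k f,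
      ∀ u : Omega k, top (treeMap hf u).1 = H u.toLE := by
  have hl : ∀ s, (stretchList H s).length = s.1.length := fun s => by simp [stretchList]
  have hg : ∀ s i (hi : i < (stretchList H s).length), (stretchList H s)[i] = H (s.take (i + 1)) :=
    fun s i hi => by simp [stretchList]
  have htop : ∀ s, s.1 ≠ [] → top (stretchList H s) = H s := by
    intro s hs
    have h1 := List.length_pos_iff.2 hs
    have h2 := hl s
    rw [top_eq_getElem (by omega), hg]
    congr 1
    exact Subtype.ext (List.take_of_length_le (by omega))
  have hs : ∀ s, (stretchList H s).Pairwise (· ≤ ·) := by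
    intro s
    rw [List.pairwise_iff_getElem]
    intro i j hi hj hij
    rw [hg, hg]
    refine (hH _ _ (ProperInit.prec (properInit_of_prefix ?_ ?_) (s.take (j + 1)).2.2)).le
    · exact List.take_prefix_take_left (by omega)
    · have := hl s
      simp only [OmegaLE.take, List.length_take]
      omega
  refine ⟨fun s => ⟨stretchList H s, (hl s).le.trans s.2.1, hs s⟩, ⟨fun s t h => ?_,
    fun s t h => ?_⟩, fun u => htop u.toLE (u.ne_nil hk)⟩
  · by_cases hs0 : s.1 = []
    · have h1 : stretchList H s = [] := by
        rw [← List.length_eq_zero_iff, hl, hs0]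
        rfl
      change Prec (stretchList H s) (stretchList H t)
      rw [h1]
      apply nil_prec
      rw [← List.length_pos_iff, hl, List.length_pos_iff]
      exact h.ne_nil
    · apply prec_of_top_lt
      change top (stretchList H s) < top (stretchList H t)
      rw [htop s hs0, htop t h.ne_nil]
      exact hH s t h
  · refine properInit_of_prefix ?_ (by
      change (stretchList H s).length < (stretchList H t).length
      rw [hl, hl]; exact h.length_lt)
    have h1 := h.1.length_le
    change stretchList H s <+: stretchList H t
    rw [List.prefix_iff_getElem]
    refine ⟨by rw [hl, hl]; exact h1, fun i hi => ?_⟩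
    rw [hg, hg]
    congr 1
    apply Subtype.ext
    obtain ⟨w, hw⟩ := h.1
    have := hl s
    simp only [OmegaLE.take]
    rw [← hw, List.take_append_of_le_length (by omega)]

/-- The first `d` members of some `X ∈ ℰ_k` can be put between prescribed rows that are
sufficiently far apart. -/
theorem exists_lowApprox_between {k d : ℕ} (hk : 0 < k) (hd : 0 < d) :
    ∃ L : ℕ, ∀ M R : ℕ → ℕ, (∀ i, M i ≤ R i) → (∀ i, R i + L < M (i + 1)) → L < M 0 →
      ∃ v : Fin d → Omega k, Finset.univ.image v ∈ lowApprox k d ∧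
        (∀ i : Fin d, top (v i).1 < M i) ∧ ∀ i j : Fin d, i < j → R i < top (v j).1 := by
  classical
  -- `S` collects the ranks of the sequences of full length; `Nat.count S` then tells how many of
  -- these precede a given one.
  let S : ℕ → Prop := fun n => ∃ u : Omega k, u.toLE.rank = n
  have hS : (Set.ofPred S).Infinite := by
    refine Set.infinite_of_injective_forall_mem (f := fun n => (Omega.const k n).toLE.rank) ?_
      fun n => ⟨_, rfl⟩
    intro m n h
    have h1 := Omega.toLE_injective k (OmegaLE.rank_injective k h)
    rw [← top_const hk m, h1, top_const hk]
  choose u hu using fun n => Nat.nth_mem_of_infinite hS n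
  -- The `i`-th full sequence will end in row `Nat.nth S i + T i`, just beyond `R (i - 1)` up to an
  -- error of at most `Nat.nth S d`. A gap `L` of this size plus one keeps it below `M i`.
  refine ⟨Nat.nth S d + 1, fun M R hMR hRM hM0 => ?_⟩
  let T : ℕ → ℕ := fun n => Nat.rec 0 (fun i _ => R i + 1) n
  have hT : Monotone T := by
    refine monotone_nat_of_le_succ fun n => ?_
    rcases n with _ | n
    · exact Nat.zero_le _
    · have h1 := hMR (n + 1)
      have h2 := hRM n
      change R n + 1 ≤ R (n + 1) + 1
      omega
  obtain ⟨f, hf, hft⟩ := exists_stretch_tree hk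
    (fun s => s.rank + T (Nat.count S s.rank)) (fun s t h => by
      have h1 := OmegaLE.rank_lt h
      have h2 := hT (Nat.count_monotone S h1.le)
      omega)
  have htop : ∀ n, top (treeMap hf (u n)).1 = Nat.nth S n + T n := by
    intro n
    rw [hft]
    rw [hu, Nat.count_nth_of_infinite hS]
  have hinj : Function.Injective fun i : Fin d => treeMap hf (u i) := by
    intro i j h
    have h1 := treeMap_injective hf h
    have h2 : Nat.nth S i = Nat.nth S j := by rw [← hu, ← hu, h1]
    exact Fin.ext ((Nat.nth_strictMono hS).injective h2)
  refine ⟨fun i => treeMap hf (u i), ⟨d, hd, le_rfl, ?_⟩, fun i => ?_, fun i j hij => ?_⟩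
  · have := mem_approxOfSize hf (F := Finset.univ.image fun i : Fin d => treeMap hf (u i))
      (fun v hv => ?_) (fun v hv w hw => ?_)
    · rwa [Finset.card_image_of_injective _ hinj, Finset.card_univ, Fintype.card_fin] at this
    · obtain ⟨i, _, rfl⟩ := Finset.mem_image.1 hv
      exact ⟨_, rfl⟩
    · obtain ⟨i, _, rfl⟩ := Finset.mem_image.1 hv
      have h1 : w.toLE.rank < (u i).toLE.rank := OmegaLE.rank_lt (hf.prec_of_prec hw)
      have hSw : S w.toLE.rank := ⟨w, rfl⟩
      have h2 := Nat.count_strict_mono hSw h1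
      rw [hu, Nat.count_nth_of_infinite hS] at h2
      refine Finset.mem_image.2 ⟨⟨_, h2.trans i.2⟩, Finset.mem_univ _, ?_⟩
      congr 1
      apply Omega.toLE_injective
      apply OmegaLE.rank_injective
      rw [hu, Nat.nth_count hSw]
  · rw [htop]
    obtain ⟨i, hi⟩ := i
    have h1 := (Nat.nth_strictMono hS).monotone hi.le
    rcases i with _ | i
    · exact (show Nat.nth S 0 + 0 < M 0 by omega)
    · have := hRM i
      exact (show Nat.nth S (i + 1) + (R i + 1) < M (i + 1) by omega)
  · rw [htop]
    have h1 : T (i + 1) ≤ T j := hT hij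
    change R i + 1 ≤ T j at h1
    omega

/-! ### Lower estimate for separated bands -/

/-- `v` extends `p` and its terms beyond `p` lie between `M` and `R`. -/
def InBand {k : ℕ} (p : List ℕ) (M R : ℕ) (v : Omega k) : Prop :=
  p <+: v.1 ∧ ∀ x ∈ v.1.drop p.length, M ≤ x ∧ x ≤ R

open Classical in
/-- Vectors living in successive, well separated bands of one tree have a lower estimate that
tends to infinity with their number. -/
theorem exists_pow_mul_le_tsirelsonNorm {k d : ℕ} (hd : 0 < d) {θ : ℝ} (h0 : 0 < θ)
    (h1 : θ < 1) {p : List ℕ} (hp : p.Pairwise (· ≤ ·)) (hpk : p.length < k) :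
    ∃ L : ℕ, ∀ (j : ℕ) (M R : ℕ → ℕ), (∀ i, M i ≤ R i) → (∀ i, R i + L < M (i + 1)) →
      L < M 0 → (∀ x ∈ p, x ≤ M 0) → ∀ (ε : ℝ) (x : Omega k →₀ ℝ),
      (∀ i < d ^ j, ε ≤ tsirelsonNorm k d θ (x.filter (InBand p (M i) (R i)))) →
      (d * θ) ^ j * ε ≤ tsirelsonNorm k d θ x := by
  obtain ⟨L, hL⟩ := exists_lowApprox_between (k := k) (d := d) (by omega) hd
  refine ⟨L, fun j => ?_⟩
  induction j with
  | zero =>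
    intro M R _ _ _ _ ε x hx
    simpa using (hx 0 (by simp)).trans (tsirelsonNorm_filter_le h0 h1 _ _)
  | succ j ih =>
    intro M R hMR hRM hM0 hpM ε x hx
    have hMm : Monotone M := monotone_nat_of_le_succ fun i => by
      have := hMR i; have := hRM i; omega
    have hRm : Monotone R := monotone_nat_of_le_succ fun i => by
      have := hMR (i + 1); have := hRM i; omega
    have hdj : 0 < d ^ j := by positivity
    -- The `d ^ (j + 1)` bands are grouped into `d` blocks of `d ^ j` consecutive ones. One
    -- approximation covers each block, and the gap before the block holds a separating point.
    let Mg : ℕ → ℕ := fun t => M (t * d ^ j)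
    let Rg : ℕ → ℕ := fun t => R (t * d ^ j + (d ^ j - 1))
    have hMRg : ∀ t, Mg t ≤ Rg t := fun t => (hMR _).trans (hRm (by omega))
    have hRMg : ∀ t, Rg t + L < Mg (t + 1) := by
      intro t
      have := hRM (t * d ^ j + (d ^ j - 1))
      rwa [show t * d ^ j + (d ^ j - 1) + 1 = (t + 1) * d ^ j by rw [add_mul]; omega] at this
    obtain ⟨v, hv, hv1, hv2⟩ := hL Mg Rg hMRg hRMg (by simpa [Mg] using hM0)
    have hM0' : ∀ i, M 0 ≤ M i := fun i => hMm (Nat.zero_le i)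
    choose E hE hE1 hE2 using fun t : Fin d => exists_approx_above (k := k) hp hpk
      (fun x hx => (hpM x hx).trans (hM0' (t * d ^ j))) (hMRg t)
    have hadm : Admissible k d E := by
      refine ⟨hd, le_rfl, hE, v, hv, fun i w hw => Or.inr (prec_of_top_lt ?_),
        fun i i' hii w hw => prec_of_top_lt ?_⟩
      · exact (hv1 i).trans_le (hE2 i w hw).1
      · exact (hE2 i w hw).2.trans_lt (hv2 i i' hii)
    refine le_trans ?_ (mul_sum_le_tsirelsonNorm h0 h1 hadm x)
    have key : ∀ t : Fin d, (d * θ) ^ j * ε ≤ tsirelsonNorm k d θ (restrict (E t) x) := by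
      intro t
      refine ih (fun i => M (t * d ^ j + i)) (fun i => R (t * d ^ j + i)) (fun i => hMR _)
        (fun i => hRM _) (hM0.trans_le (hM0' _)) (fun x hx => (hpM x hx).trans (hM0' _)) ε _
        fun i hi => ?_
      have ht : (t : ℕ) * d ^ j + i < d ^ (j + 1) := by
        have h2 : ((t : ℕ) + 1) * d ^ j ≤ d * d ^ j := Nat.mul_le_mul_right _ t.2
        rw [pow_succ, mul_comm (d ^ j)]
        rw [add_mul] at h2
        omega
      refine (hx _ ht).trans (tsirelsonNorm_mono_abs h0 h1 fun w => ?_)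
      rw [Finsupp.filter_apply, Finsupp.filter_apply]
      split_ifs with hw
      · rw [restrict_apply, if_pos]
        refine hE1 t w hw.1 fun x hx => ?_
        have h2 := hw.2 x hx
        exact ⟨(hMm (Nat.le_add_right _ _)).trans h2.1, h2.2.trans (hRm (by omega))⟩
      · exact le_rfl
    calc (d * θ) ^ (j + 1) * ε = θ * ∑ _t : Fin d, (d * θ) ^ j * ε := by
          rw [Finset.sum_const, Finset.card_univ, Fintype.card_fin, nsmul_eq_mul, pow_succ]
          ring
      _ ≤ _ := mul_le_mul_of_nonneg_left (Finset.sum_le_sum fun t _ => key t) h0.le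

/-! ### Upper estimate for distinct branches -/

/-- The zero sequence is the `≺`-least of full length, so its image is the first member of the range
and lies in every nonempty initial part. -/
theorem exists_tree_of_mem_approx {k : ℕ} {E : Finset (Omega k)} (hE : E ∈ approx k) :
    ∃ f : OmegaLE k → OmegaLE k, ∃ hf : IsEllentuckTree k f,
      treeMap hf (Omega.const k 0) ∈ E ∧ ∀ v ∈ E, ∃ u, treeMap hf u = v := by
  obtain ⟨n, hn, X, ⟨f, hf, rfl⟩, hcard, h1, h2⟩ := hE
  have h3 : ∀ v ∈ E, ∃ u, treeMap hf u = v := by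
    intro v hv
    obtain ⟨u, hu⟩ := h1 v hv
    exact ⟨u, Subtype.ext hu⟩
  refine ⟨f, hf, ?_, h3⟩
  obtain ⟨v, hv⟩ := Finset.card_pos.1 (show 0 < E.card by omega)
  obtain ⟨u, rfl⟩ := h3 v hv
  rcases const_zero_prec u with rfl | h
  · exact hv
  · exact h2 _ hv _ ⟨_, rfl⟩ (hf.1 (Omega.const k 0).toLE u.toLE h)

/-- If `E` lies above the row `B`, then its members have at most one initial segment of length `n`
in the rows up to `B`. -/
theorem take_eq_of_mem_approx {k B n : ℕ} {E : Finset (Omega k)} (hE : E ∈ approx k)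
    (hB : ∀ v ∈ E, B < top v.1) {u w : Omega k} (hu : u ∈ E) (hw : w ∈ E)
    (hu' : top (u.1.take n) ≤ B) (hw' : top (w.1.take n) ≤ B) : u.1.take n = w.1.take n := by
  obtain ⟨f, hf, hz, hs⟩ := exists_tree_of_mem_approx hE
  -- A sequence with a positive last term comes after the zero sequence, so its image lies in no
  -- earlier row than a member of `E`, hence beyond `B`.
  have key : ∀ s : Omega k, top ((treeMap hf s).1.take n) ≤ B → ∀ x ∈ s.1.take n, x = 0 := by
    intro s h x hx
    by_contra hx0
    have h1 : top (f (s.toLE.take n)).1 ≤ B := by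
      rw [hf.take]
      exact h
    have hk : 0 < k := by
      rw [← s.2.1]
      exact List.length_pos_of_mem (List.mem_of_mem_take hx)
    have h2 : top (Omega.const k 0).1 < top (s.toLE.take n).1 := by
      rw [top_const hk]
      exact (Nat.pos_of_ne_zero hx0).trans_le (le_top (s.toLE.take n).2.2 hx)
    have h3 := (hf.1 (Omega.const k 0).toLE _ (prec_of_top_lt h2)).top_le
    have h4 : B < top (f (Omega.const k 0).toLE).1 := hB _ hz
    omega
  obtain ⟨s, rfl⟩ := hs u hu
  obtain ⟨t, rfl⟩ := hs w hw
  have h1 : s.1.take n = t.1.take n := by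
    have h2 := List.eq_replicate_iff.2 ⟨rfl, key s hu'⟩
    have h3 := List.eq_replicate_iff.2 ⟨rfl, key t hw'⟩
    rw [h2, h3, List.length_take, List.length_take, s.2.1, t.2.1]
  have h2 : s.toLE.take n = t.toLE.take n := Subtype.ext h1
  have h3 := hf.take s.toLE n
  rw [h2, hf.take] at h3
  exact (congrArg (fun s : OmegaLE k => s.1) h3).symm

theorem l1Norm_le_one {k : ℕ} {x : Omega k →₀ ℝ} (hx : ∀ v, |x v| ≤ 1)
    (hs : ∀ u w, x u ≠ 0 → x w ≠ 0 → u = w) : l1Norm x ≤ 1 := by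
  refine (Finset.sum_le_card_nsmul _ _ 1 fun v _ => hx v).trans ?_
  have : x.support.card ≤ 1 := Finset.card_le_one.2 fun u hu w hw =>
    hs u w (Finsupp.mem_support_iff.1 hu) (Finsupp.mem_support_iff.1 hw)
  simpa using this

/-- Unit vectors far out in different branches span a copy of `ℓ_∞^n`. -/
theorem tsirelsonNorm_le_of_branches {k d : ℕ} (hd : 0 < d) {θ : ℝ} (h0 : 0 < θ) (h1 : θ < 1)
    {B n : ℕ} {U : Set (Omega k)} (hU : ∀ u ∈ U, B < top u.1)
    (hn : ∀ u ∈ U, top (u.1.take n) ≤ B)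
    (hinj : ∀ u ∈ U, ∀ w ∈ U, u.1.take n = w.1.take n → u = w) {x : Omega k →₀ ℝ}
    (hx : ∀ v, |x v| ≤ 1) (hxU : ∀ v, x v ≠ 0 → v ∈ U) :
    tsirelsonNorm k d θ x ≤ d / (1 - θ) := by
  have hθ : 0 < 1 - θ := by linarith
  have hd1 : (1 : ℝ) ≤ d := by exact_mod_cast hd
  have hC : 1 ≤ d / (1 - θ) := by
    rw [le_div_iff₀ hθ]
    linarith
  -- This amounts to `θ * (2 - θ) ≤ 1`.
  have hCθ : θ * (d / (1 - θ) + d) ≤ d / (1 - θ) := by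
    have h2 : d / (1 - θ) * (1 - θ) = d := div_mul_cancel₀ _ hθ.ne'
    nlinarith
  refine ciSup_le fun j => ?_
  induction j generalizing x with
  | zero => exact Real.iSup_le (fun v => (hx v).trans hC) (zero_le_one.trans hC)
  | succ j ih =>
    refine max_le (ih hx hxU) ?_
    refine le_trans ?_ hCθ
    refine mul_le_mul_of_nonneg_left (Real.sSup_le ?_ (by positivity)) h0.le
    rintro _ ⟨m, E, hE, rfl⟩
    have hrx : ∀ i v, |restrict (E i) x v| ≤ 1 := by
      intro i v
      rw [restrict_apply]
      split_ifs
      · exact hx v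
      · simp
    have hrU : ∀ i v, restrict (E i) x v ≠ 0 → v ∈ E i ∧ v ∈ U := by
      intro i v h
      rw [restrict_apply] at h
      split_ifs at h with hv
      · exact ⟨hv, hxU v h⟩
      · exact absurd rfl h
    -- Only the first piece that meets `U` can be large. Later pieces lie beyond a point of `U`,
    -- hence beyond row `B`, and contain at most one point of `U`.
    have hone : ∃ i₀, ∀ i ≠ i₀, normStep k d θ j (restrict (E i) x) ≤ 1 := by
      obtain ⟨hm, _, hEa, v, _, hv1, hv2⟩ := hE
      by_cases hA : ∃ i, ∃ w ∈ E i, w ∈ U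
      · classical
        let A : Finset (Fin m) := Finset.univ.filter fun i => ∃ w ∈ E i, w ∈ U
        have hAne : A.Nonempty := by
          obtain ⟨i, hi⟩ := hA
          exact ⟨i, by simpa [A] using hi⟩
        obtain ⟨w, hw, hwU⟩ := (Finset.mem_filter.1 (A.min'_mem hAne)).2
        refine ⟨A.min' hAne, fun i hi => (normStep_le_l1Norm k d h0 h1 j _).trans
          (l1Norm_le_one (hrx i) fun u u' hu hu' => ?_)⟩
        have hu := hrU i u hu
        have hu' := hrU i u' hu'
        have hlt : A.min' hAne < i :=
          lt_of_le_of_ne (A.min'_le i (Finset.mem_filter.2 ⟨Finset.mem_univ _, u, hu⟩)) hi.symm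
        have hB : ∀ v' ∈ E i, B < top v'.1 := by
          intro v' hv'
          have h2 := hU w hwU
          have h3 := (hv2 _ _ hlt w hw).top_le
          rcases hv1 i v' hv' with h4 | h4
          · rw [← h4]
            omega
          · have := h4.top_le
            omega
        exact hinj u hu.2 u' hu'.2
          (take_eq_of_mem_approx (hEa i) hB hu.1 hu'.1 (hn u hu.2) (hn u' hu'.2))
      · refine ⟨⟨0, hm⟩, fun i _ => (normStep_le_l1Norm k d h0 h1 j _).trans
          (l1Norm_le_one (hrx i) fun u w hu _ => ?_)⟩
        exact absurd ⟨i, u, hrU i u hu⟩ hA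
    obtain ⟨i₀, hi₀⟩ := hone
    have hterm : ∀ i, normStep k d θ j (restrict (E i) x) ≤
        (if i = i₀ then d / (1 - θ) else 0) + 1 := by
      intro i
      split_ifs with h
      · have := ih (hrx i) fun v hv => (hrU i v hv).2
        linarith
      · simpa using hi₀ i h
    refine (Finset.sum_le_sum fun i _ => hterm i).trans ?_
    have hm : (m : ℝ) ≤ d := by exact_mod_cast hE.2.1
    simp [Finset.sum_add_distrib, hm]

/-! ### Iterated limits along extensions -/

open Filter

/-- The filter of the extensions of `α` by `n` terms, which tend to infinity one after the other. -/
def extFilter : ℕ → List ℕ → Filter (List ℕ)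
  | 0, α => pure α
  | n + 1, α => atTop.bind fun b => extFilter n (α ++ [b])

theorem extFilter_neBot (n : ℕ) (α : List ℕ) : (extFilter n α).NeBot := by
  rw [neBot_iff, Ne, ← eventually_false_iff_eq_bot]
  induction n generalizing α with
  | zero => simp [extFilter]
  | succ n ih =>
    rw [extFilter, eventually_bind]
    intro h
    obtain ⟨b, hb⟩ := h.exists
    exact ih _ hb

theorem pairwise_append_singleton {α : List ℕ} (hα : α.Pairwise (· ≤ ·)) {b : ℕ}
    (hb : top α ≤ b) : (α ++ [b]).Pairwise (· ≤ ·) := by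
  rw [List.pairwise_append]
  refine ⟨hα, List.pairwise_singleton _ _, fun a ha c hc => ?_⟩
  rw [List.mem_singleton.1 hc]
  exact (le_top hα ha).trans hb

theorem top_append_singleton (α : List ℕ) (b : ℕ) : top (α ++ [b]) = b := by
  rw [top_eq_getLast (by simp)]
  simp

/-- The filter lives on arbitrary lists. Almost all of them are non-decreasing and of the right
length, so a claim about every `u` with `u.1 = l` is not vacuous. -/
theorem eventually_extFilter (B n : ℕ) {α : List ℕ} (hα : α.Pairwise (· ≤ ·)) :
    ∀ᶠ u in extFilter n α, α <+: u ∧ u.length = α.length + n ∧ u.Pairwise (· ≤ ·) ∧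
      (0 < n → B ≤ top u) := by
  induction n generalizing α with
  | zero =>
    simp only [extFilter, eventually_pure]
    exact ⟨List.prefix_rfl, rfl, hα, fun h => absurd h (lt_irrefl _)⟩
  | succ n ih =>
    rw [extFilter, eventually_bind]
    filter_upwards [eventually_ge_atTop (top α), eventually_ge_atTop B] with b hb hB
    filter_upwards [ih (pairwise_append_singleton hα hb)] with u hu
    refine ⟨(List.prefix_append _ _).trans hu.1, ?_, hu.2.2.1, fun _ => hB.trans ?_⟩
    · rw [hu.2.1, List.length_append]
      simp
      omega
    · exact le_top hu.2.2.1 (hu.1.subset (by simp))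

theorem sum_single_apply {k : ℕ} (U : Finset (Omega k)) (v : Omega k) [Decidable (v ∈ U)] :
    (∑ u ∈ U, Finsupp.single u (1 : ℝ)) v = if v ∈ U then 1 else 0 := by
  classical
  rw [Finsupp.finsetSum_apply]
  simp only [Finsupp.single_apply]
  rw [Finset.sum_ite_eq']
  congr

theorem abs_sum_single_le {k : ℕ} (U : Finset (Omega k)) (v : Omega k) :
    |(∑ u ∈ U, Finsupp.single u (1 : ℝ)) v| ≤ 1 := by
  classical
  rw [sum_single_apply]
  split_ifs <;> simp

theorem mem_of_sum_single_ne {k : ℕ} {U : Finset (Omega k)} {v : Omega k}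
    (h : (∑ u ∈ U, Finsupp.single u (1 : ℝ)) v ≠ 0) : v ∈ U := by
  classical
  rw [sum_single_apply] at h
  by_contra hv
  simp [hv] at h

theorem l1Norm_sum_single_le {k : ℕ} (U : Finset (Omega k)) :
    l1Norm (∑ u ∈ U, Finsupp.single u (1 : ℝ)) ≤ U.card := by
  refine (Finset.sum_le_card_nsmul _ _ 1 fun v _ => abs_sum_single_le U v).trans ?_
  rw [nsmul_eq_mul, mul_one]
  exact_mod_cast Finset.card_le_card fun v hv => mem_of_sum_single_ne (Finsupp.mem_support_iff.1 hv)

/-! ### Decay of single coordinates -/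

/-- The images of the unit vectors of `T(𝒜_d^K, θ)` tend to zero coordinatewise. -/
theorem exists_card_le_of_le_abs {K k d : ℕ} {θ : ℝ} (h0 : 0 < θ) (h1 : θ < 1)
    {y : Omega K → Omega k →₀ ℝ} {A : ℝ} (hA0 : 0 ≤ A)
    (hA : ∀ U : Finset (Omega K), tsirelsonNorm k d θ (∑ u ∈ U, y u) ≤
      A * tsirelsonNorm K d θ (∑ u ∈ U, Finsupp.single u 1) + 1)
    (v : Omega k) {ε : ℝ} (hε : 0 < ε) :
    ∃ N : ℕ, ∀ U : Finset (Omega K), (∀ u ∈ U, ε ≤ |y u v|) → U.card ≤ N := by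
  classical
  -- Splitting `U` by sign doubles the bound `A * (θ ^ j * U.card + B) + 1`. With `4 * A * θ ^ j ≤
  -- ε` its linear part is at most half of `U.card * ε` and can be absorbed.
  obtain ⟨j, hj⟩ := exists_pow_lt_of_lt_one (show 0 < ε / (4 * (A + 1)) by positivity) h1
  obtain ⟨B, hB, hN⟩ := exists_tsirelsonNorm_le K d h0 h1 j
  have hj' : 4 * (A * θ ^ j) ≤ ε := by
    rw [lt_div_iff₀ (by positivity)] at hj
    nlinarith [pow_pos h0 j]
  obtain ⟨N, hN'⟩ := exists_nat_ge (4 * (A * B + 1) / ε)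
  refine ⟨N, fun U hU => ?_⟩
  have key : ∀ V ⊆ U, |∑ u ∈ V, y u v| ≤ A * (θ ^ j * U.card + B) + 1 := by
    intro V hV
    have h2 := abs_le_tsirelsonNorm (d := d) h0 h1 (∑ u ∈ V, y u) v
    rw [Finsupp.finsetSum_apply] at h2
    refine (h2.trans (hA V)).trans (add_le_add_left (mul_le_mul_of_nonneg_left ?_ hA0) 1)
    refine (hN _ (abs_sum_single_le V)).trans (add_le_add_left
      (mul_le_mul_of_nonneg_left ((l1Norm_sum_single_le V).trans ?_) (by positivity)) B)
    exact_mod_cast Finset.card_le_card hV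
  have h2 : U.card * ε ≤ ∑ u ∈ U, |y u v| := by
    rw [← nsmul_eq_mul]
    exact Finset.card_nsmul_le_sum _ _ _ hU
  have h3 : ∑ u ∈ U, |y u v| = ∑ u ∈ U with 0 ≤ y u v, y u v - ∑ u ∈ U with ¬ 0 ≤ y u v, y u v := by
    rw [← Finset.sum_filter_add_sum_filter_not U (fun u => 0 ≤ y u v), sub_eq_add_neg,
      ← Finset.sum_neg_distrib]
    congr 1
    · exact Finset.sum_congr rfl fun u hu => abs_of_nonneg (Finset.mem_filter.1 hu).2
    · exact Finset.sum_congr rfl fun u hu =>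
        abs_of_neg (not_le.1 (Finset.mem_filter.1 hu).2)
  have h4 := (le_abs_self _).trans (key _ (Finset.filter_subset (fun u => 0 ≤ y u v) U))
  have h5 := (neg_le_abs _).trans (key _ (Finset.filter_subset (fun u => ¬ 0 ≤ y u v) U))
  have h6 : (U.card : ℝ) * ε ≤ 4 * (A * B + 1) := by
    have h7 := mul_le_mul_of_nonneg_left hj' (Nat.cast_nonneg (α := ℝ) U.card)
    nlinarith
  rw [← le_div_iff₀ hε] at h6
  exact_mod_cast h6.trans hN'

/-! ### Decay above a node, by induction towards the root -/

/-- The restriction of `x` to the tree above `p`. -/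
noncomputable def branchPart {k : ℕ} (p : List ℕ) (x : Omega k →₀ ℝ) : Omega k →₀ ℝ :=
  x.filter fun v => p <+: v.1

theorem branchPart_apply {k : ℕ} (p : List ℕ) (x : Omega k →₀ ℝ) (v : Omega k) :
    branchPart p x v = if p <+: v.1 then x v else 0 := by
  rw [branchPart, Finsupp.filter_apply]

theorem exists_prefix_of_branchPart {k d : ℕ} {θ : ℝ} (h0 : 0 < θ) (h1 : θ < 1) {p : List ℕ}
    {x : Omega k →₀ ℝ} (h : 0 < tsirelsonNorm k d θ (branchPart p x)) :
    ∃ v : Omega k, p <+: v.1 := by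
  by_contra! hv
  have : branchPart p x = 0 := by
    ext v
    simp [branchPart_apply, hv v]
  rw [this, tsirelsonNorm_zero h0 h1] at h
  exact lt_irrefl _ h

/-- `v` extends `p` and has a term beyond `p` that is smaller than `M`. -/
def IsLow {k : ℕ} (p : List ℕ) (M : ℕ) (v : Omega k) : Prop :=
  p <+: v.1 ∧ ∃ a ∈ v.1.drop p.length, a < M

-- Since the terms do not decrease, a small term beyond `p` forces the first term beyond `p` to be
-- small, so `v` lies above one of finitely many children of `p`.
open Classical in
theorem tsirelsonNorm_low_le {k d : ℕ} {θ : ℝ} (h0 : 0 < θ) (h1 : θ < 1) (p : List ℕ)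
    (M : ℕ) (x : Omega k →₀ ℝ) :
    tsirelsonNorm k d θ (x.filter (IsLow p M)) ≤
      ∑ a ∈ Finset.range M, tsirelsonNorm k d θ (branchPart (p ++ [a]) x) := by
  refine (tsirelsonNorm_mono_abs h0 h1 fun v => ?_).trans (tsirelsonNorm_sum_le h0 h1 _ _)
  rw [Finsupp.filter_apply, Finsupp.finsetSum_apply]
  split_ifs with h
  · obtain ⟨⟨w, hw⟩, a, ha, haM⟩ := h
    rw [← hw, List.drop_left] at ha
    rcases w with _ | ⟨b, w⟩
    · simp at ha
    have hbM : b < M := by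
      refine lt_of_le_of_lt ?_ haM
      have h2 := v.2.2
      rw [← hw, List.pairwise_append, List.pairwise_cons] at h2
      rcases List.mem_cons.1 ha with h | h
      · exact h.ge
      · exact h2.2.1.1 a h
    rw [Finset.sum_eq_single b]
    · rw [branchPart_apply, if_pos ⟨w, by rw [← hw]; simp⟩]
    · intro c _ hcb
      rw [branchPart_apply, if_neg]
      rintro ⟨w', hw'⟩
      rw [← hw, List.append_assoc] at hw'
      have := List.append_cancel_left hw'
      simp at this
      exact hcb this.1
    · intro hb
      exact absurd (Finset.mem_range.2 hbM) hb
  · simp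

theorem eventually_branchPart_lt_of_length_eq {K k d : ℕ} {θ : ℝ} (h0 : 0 < θ) (h1 : θ < 1)
    {y : Omega K → Omega k →₀ ℝ} {A : ℝ} (hA0 : 0 ≤ A)
    (hA : ∀ U : Finset (Omega K), tsirelsonNorm k d θ (∑ u ∈ U, y u) ≤
      A * tsirelsonNorm K d θ (∑ u ∈ U, Finsupp.single u 1) + 1)
    (α p : List ℕ) (hp : p.length = k) {ε : ℝ} (hε : 0 < ε) :
    ∀ᶠ l in extFilter 1 α, ∀ u : Omega K, u.1 = l →
      tsirelsonNorm k d θ (branchPart p (y u)) < ε := by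
  classical
  by_contra hcon
  rw [not_eventually, extFilter, frequently_bind] at hcon
  simp only [extFilter, frequently_pure, not_forall, not_lt] at hcon
  obtain ⟨φ, hφ, hu⟩ := extraction_of_frequently_atTop hcon
  choose u hu hu' using hu
  obtain ⟨v, hv⟩ := exists_prefix_of_branchPart h0 h1 (hε.trans_le (hu' 0))
  have hv : p = v.1 := hv.eq_of_length (hp.trans v.2.1.symm)
  obtain ⟨N, hN⟩ := exists_card_le_of_le_abs h0 h1 hA0 hA v hε
  have hinj : Function.Injective u := by
    intro i j h
    have h2 := hu i
    rw [h, hu j] at h2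
    apply hφ.injective
    simpa using h2.symm
  have hle : ∀ i, ε ≤ |y (u i) v| := by
    intro i
    refine (hu' i).trans ((tsirelsonNorm_le_l1Norm h0 h1 _).trans ?_)
    have : branchPart p (y (u i)) = Finsupp.single v (y (u i) v) := by
      ext w
      rw [branchPart_apply, Finsupp.single_apply]
      by_cases h : v = w
      · rw [← h, if_pos (hv ▸ List.prefix_rfl), if_pos rfl]
      · rw [if_neg h, if_neg]
        intro h2
        exact h (Subtype.ext (hv ▸ h2.eq_of_length (hp.trans w.2.1.symm)))
    rw [this, l1Norm]
    refine (Finset.sum_le_sum_of_subset_of_nonneg Finsupp.support_single_subset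
      fun _ _ _ => abs_nonneg _).trans ?_
    simp
  have h2 := hN ((Finset.range (N + 1)).image u) (fun w hw => by
    obtain ⟨i, _, rfl⟩ := Finset.mem_image.1 hw
    exact hle i)
  rw [Finset.card_image_of_injective _ hinj, Finset.card_range] at h2
  omega

-- The inductive step, by contradiction: a gliding hump along distinct branches above `α`, with
-- humps in successive bands above `p`.
open Classical in
theorem eventually_branchPart_lt_succ {K k d : ℕ} {θ : ℝ} (hd : 0 < d) (h0 : 0 < θ)
    (h1 : θ < 1) (hdθ : 1 < d * θ)
    {y : Omega K → Omega k →₀ ℝ} {A : ℝ} (hA0 : 0 ≤ A)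
    (hA : ∀ U : Finset (Omega K), tsirelsonNorm k d θ (∑ u ∈ U, y u) ≤
      A * tsirelsonNorm K d θ (∑ u ∈ U, Finsupp.single u 1) + 1)
    {n : ℕ} (hn : 0 < n) {α p : List ℕ} (hα : α.Pairwise (· ≤ ·))
    (hαn : α.length + (n + 1) = K) (hpn : p.length + n = k)
    (ih : ∀ b, top α ≤ b → ∀ a, ∀ ε : ℝ, 0 < ε → ∀ᶠ l in extFilter n (α ++ [b]),
      ∀ u : Omega K, u.1 = l → tsirelsonNorm k d θ (branchPart (p ++ [a]) (y u)) < ε)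
    {ε : ℝ} (hε : 0 < ε) :
    ∀ᶠ l in extFilter (n + 1) α, ∀ u : Omega K, u.1 = l →
      tsirelsonNorm k d θ (branchPart p (y u)) < ε := by
  have hpk : p.length < k := by omega
  by_contra hcon
  rw [not_eventually, extFilter, frequently_bind] at hcon
  obtain ⟨φ, hφ, hfr⟩ := extraction_of_frequently_atTop
    (hcon.and_eventually (eventually_ge_atTop (top α)))
  simp only [not_forall, not_lt] at hfr
  have hp : p.Pairwise (· ≤ ·) := by
    obtain ⟨l, u, rfl, hu⟩ := (hfr 0).1.exists
    obtain ⟨v, hv⟩ := exists_prefix_of_branchPart h0 h1 (hε.trans_le hu)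
    exact v.2.2.sublist hv.sublist
  obtain ⟨L, hL⟩ := exists_pow_mul_le_tsirelsonNorm (k := k) hd h0 h1 hp hpk
  -- `j` makes the lower estimate for `d ^ j` humps of size `ε / 2` exceed what the `ℓ_∞` estimate
  -- allows.
  obtain ⟨j, hj⟩ := pow_unbounded_of_one_lt ((A * (d / (1 - θ)) + 1) / (ε / 2)) hdθ
  rw [div_lt_iff₀ (by positivity)] at hj
  have hN : 0 < d ^ j := by positivity
  set N := d ^ j with hNdef
  have hNR : (0 : ℝ) < N := by exact_mod_cast hN
  -- In each band there are `N` errors of size `η`: one from the low part of its own vector and `N -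
  -- 1` from the others. Together they cost `ε / 2`.
  set η : ℝ := ε / (2 * N) with hη
  have hη0 : 0 < η := by positivity
  have hgood : ∀ i M : ℕ, ∃ u : Omega K, α ++ [φ i] <+: u.1 ∧ φ N < top u.1 ∧
      ε ≤ tsirelsonNorm k d θ (branchPart p (y u)) ∧ ∀ a ∈ Finset.range M,
        tsirelsonNorm k d θ (branchPart (p ++ [a]) (y u)) < η / (M + 1) := by
    intro i M
    have h2 := (eventually_all_finset (Finset.range M)).2 fun a _ =>
      ih (φ i) (hfr i).2 a (η / (M + 1)) (by positivity)
    have h3 := eventually_extFilter (φ N + 1) n (pairwise_append_singleton hα (hfr i).2)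
    obtain ⟨l, ⟨u, rfl, hu⟩, h4, h5⟩ := ((hfr i).1.and_eventually (h2.and h3)).exists
    exact ⟨u, h5.1, h5.2.2.2 hn, hu, fun a ha => h4 a ha u rfl⟩
  choose g hg1 hg2 hg3 hg4 using hgood
  let bd : (Omega k →₀ ℝ) → ℕ := fun x => x.support.sup fun v => top v.1
  have hbd : ∀ x v, x v ≠ 0 → top v.1 ≤ bd x := fun x v hv =>
    Finset.le_sup (f := fun v : Omega k => top v.1) (Finsupp.mem_support_iff.2 hv)
  -- Each band starts more than `L` beyond the supports of the earlier vectors; the first one starts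
  -- beyond `L` and the terms of `p`.
  let M : ℕ → ℕ := fun i => Nat.rec (L + 1 + top p)
    (fun i m => max m (bd (y (g i m))) + L + 1) i
  let R : ℕ → ℕ := fun i => max (M i) (bd (y (g i (M i))))
  let u : ℕ → Omega K := fun i => g i (M i)
  have hMR : ∀ i, M i ≤ R i := fun i => le_max_left _ _
  have hMs : ∀ i, M (i + 1) = R i + L + 1 := fun i => rfl
  have hMm : Monotone M := monotone_nat_of_le_succ fun i => by
    have := hMR i; have := hMs i; omega
  have hRM : ∀ i i', i < i' → R i < M i' := fun i i' h => by
    have h2 : M (i + 1) ≤ M i' := hMm h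
    have := hMs i
    omega
  have htake : ∀ i, (u i).1.take (α.length + 1) = α ++ [φ i] := fun i => by
    have h2 := List.prefix_iff_eq_take.1 (hg1 i (M i))
    rw [List.length_append] at h2
    exact h2.symm
  have huinj : Function.Injective u := by
    intro i i' h
    have h2 := htake i
    rw [h, htake i'] at h2
    apply hφ.injective
    simpa using h2.symm
  -- The part of `y (u i)` in the branches that start below `M i` is negligible.
  have hlow : ∀ i, tsirelsonNorm k d θ ((y (u i)).filter (IsLow p (M i))) ≤ η := by
    intro i
    refine (tsirelsonNorm_low_le h0 h1 p (M i) (y (u i))).trans ?_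
    refine (Finset.sum_le_card_nsmul _ _ _ fun a ha => (hg4 i (M i) a ha).le).trans ?_
    rw [Finset.card_range, nsmul_eq_mul, ← mul_div_assoc, div_le_iff₀ (by positivity)]
    nlinarith
  have hband : ∀ i, ε ≤ η + tsirelsonNorm k d θ ((y (u i)).filter (InBand p (M i) (R i))) := by
    intro i
    refine (hg3 i (M i)).trans (le_trans ?_ (add_le_add_left (hlow i) _))
    refine le_trans (tsirelsonNorm_mono_abs h0 h1 fun v => ?_) (tsirelsonNorm_add_le h0 h1 _ _)
    rw [branchPart_apply, Finsupp.add_apply, Finsupp.filter_apply, Finsupp.filter_apply]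
    by_cases hv : p <+: v.1
    · by_cases hv' : IsLow p (M i) v
      · have h2 : ¬ InBand p (M i) (R i) v := by
          rintro ⟨_, h2⟩
          obtain ⟨_, a, ha, haM⟩ := hv'
          have := h2 a ha
          omega
        rw [if_pos hv, if_pos hv', if_neg h2, add_zero]
      · rw [if_pos hv, if_neg hv', zero_add]
        split_ifs with h2
        · exact le_rfl
        · have h3 : y (u i) v = 0 := by
            by_contra h3
            refine h2 ⟨hv, fun a ha => ⟨?_, ?_⟩⟩
            · by_contra h4
              exact hv' ⟨hv, a, ha, not_le.1 h4⟩
            · exact (le_top v.2.2 (List.mem_of_mem_drop ha)).trans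
                ((hbd _ _ h3).trans (le_max_right _ _))
          change |y (u i) v| ≤ _
          simp [h3]
    · simp [hv, InBand, IsLow]
  -- An earlier vector has its support below band `i`; for a later vector, band `i` is contained in
  -- its negligible low part.
  have hoff : ∀ i i', i' ≠ i →
      tsirelsonNorm k d θ ((y (u i')).filter (InBand p (M i) (R i))) ≤ η := by
    intro i i' hii
    refine le_trans (tsirelsonNorm_mono_abs h0 h1 fun v => ?_) (hlow i')
    rw [Finsupp.filter_apply, Finsupp.filter_apply]
    split_ifs with h2 h3 h3
    · exact le_rfl
    · suffices y (u i') v = 0 by simp [this]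
      by_contra h4
      have hl : 0 < (v.1.drop p.length).length := by
        rw [List.length_drop, v.2.1]
        omega
      have hmem := List.getElem_mem hl
      have h5 := h2.2 _ hmem
      rcases lt_or_gt_of_ne hii with h6 | h6
      · have h7 := hRM _ _ h6
        have h8 : top v.1 ≤ R i' := (hbd _ _ h4).trans (le_max_right _ _)
        have h9 := le_top v.2.2 (List.mem_of_mem_drop hmem)
        omega
      · have h7 := hRM _ _ h6
        exact h3 ⟨h2.1, _, hmem, by omega⟩
    · simp
    · exact le_rfl
  let U : Finset (Omega K) := (Finset.range N).image u
  have hUsum : ∑ w ∈ U, y w = ∑ i ∈ Finset.range N, y (u i) :=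
    Finset.sum_image fun _ _ _ _ h => huinj h
  have hlower : (d * θ) ^ j * (ε / 2) ≤ tsirelsonNorm k d θ (∑ w ∈ U, y w) := by
    refine hL j M R hMR (fun i => by have := hMs i; omega)
      (show L < L + 1 + top p by omega) (fun x hx => ?_) _ _ fun i hi => ?_
    · have := le_top hp hx
      exact (show x ≤ L + 1 + top p by omega)
    · have hi' : i ∈ Finset.range N := Finset.mem_range.2 hi
      have h2 : (y (u i)).filter (InBand p (M i) (R i)) =
          (∑ w ∈ U, y w).filter (InBand p (M i) (R i)) +
          ∑ i' ∈ (Finset.range N).erase i, -(y (u i')).filter (InBand p (M i) (R i)) := by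
        rw [hUsum, Finsupp.filter_sum, ← Finset.add_sum_erase _ _ hi', Finset.sum_neg_distrib]
        abel
      have h3 := (tsirelsonNorm_sum_le (d := d) h0 h1 ((Finset.range N).erase i)
        fun i' => -(y (u i')).filter (InBand p (M i) (R i))).trans
        (Finset.sum_le_card_nsmul _ _ η fun i' hi' => by
          rw [tsirelsonNorm_neg h0 h1]
          exact hoff i i' (Finset.ne_of_mem_erase hi'))
      have h4 := hband i
      rw [h2] at h4
      have h5 := h4.trans (add_le_add_right ((tsirelsonNorm_add_le h0 h1 _ _).trans
        (add_le_add_right h3 _)) η)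
      rw [Finset.card_erase_of_mem hi', Finset.card_range, nsmul_eq_mul, Nat.cast_pred hN] at h5
      have h6 : N * η = ε / 2 := by
        rw [hη]
        field_simp
      linarith
  -- Row `φ N` separates: the chosen branching nodes lie at or below it, and every `u i` ends beyond
  -- it.
  have hupper := tsirelsonNorm_le_of_branches (k := K) hd h0 h1 (B := φ N) (n := α.length + 1)
    (U := (U : Set (Omega K))) (x := ∑ u ∈ U, Finsupp.single u 1) (fun w hw => ?_)
    (fun w hw => ?_) (fun w hw w' hw' h => ?_) (abs_sum_single_le U)
    (fun v hv => mem_of_sum_single_ne hv)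
  · have := hA U
    nlinarith
  · obtain ⟨i, _, rfl⟩ := Finset.mem_image.1 hw
    exact hg2 i (M i)
  · obtain ⟨i, hi, rfl⟩ := Finset.mem_image.1 hw
    rw [htake, top_append_singleton]
    exact hφ.monotone (Finset.mem_range.1 hi).le
  · obtain ⟨i, hi, rfl⟩ := Finset.mem_image.1 hw
    obtain ⟨i', hi', rfl⟩ := Finset.mem_image.1 hw'
    rw [htake, htake] at h
    congr 1
    apply hφ.injective
    simpa using h

/-- Each step shortens `α` and `p` by one term together. The offset `k + 1` is there because `n = 1`
already belongs to nodes `p` of full length. -/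
theorem eventually_branchPart_lt {K k d : ℕ} {θ : ℝ} (hd : 0 < d) (h0 : 0 < θ)
    (h1 : θ < 1) (hdθ : 1 < d * θ)
    {y : Omega K → Omega k →₀ ℝ} {A : ℝ} (hA0 : 0 ≤ A)
    (hA : ∀ U : Finset (Omega K), tsirelsonNorm k d θ (∑ u ∈ U, y u) ≤
      A * tsirelsonNorm K d θ (∑ u ∈ U, Finsupp.single u 1) + 1)
    {n : ℕ} (hn : 1 ≤ n) : ∀ {α p : List ℕ}, α.Pairwise (· ≤ ·) → α.length + n = K →
      p.length + n = k + 1 → ∀ {ε : ℝ}, 0 < ε → ∀ᶠ l in extFilter n α, ∀ u : Omega K, u.1 = l →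
        tsirelsonNorm k d θ (branchPart p (y u)) < ε := by
  induction n, hn using Nat.le_induction with
  | base =>
    intro α p _ _ hp ε hε
    exact eventually_branchPart_lt_of_length_eq h0 h1 hA0 hA α p (by omega) hε
  | succ n hn ih =>
    intro α p hα hαn hpn ε hε
    refine eventually_branchPart_lt_succ hd h0 h1 hdθ hA0 hA hn hα hαn (by omega)
      (fun b hb a ε' hε' => ih (pairwise_append_singleton hα hb) ?_ ?_ hε') hε
    · simp; omega
    · simp; omega

/-- There is no seminormalized image, in `T(𝒜_d^k, θ)`, of the unit vector basis of
`T(𝒜_d^K, θ)` when `k < K`. -/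
theorem not_seminormalized_image {K k d : ℕ} (hk : k < K) {θ : ℝ} (hd : 0 < d) (h0 : 0 < θ)
    (h1 : θ < 1) (hdθ : 1 < d * θ)
    {y : Omega K → Omega k →₀ ℝ} {A c : ℝ} (hA0 : 0 ≤ A)
    (hA : ∀ U : Finset (Omega K), tsirelsonNorm k d θ (∑ u ∈ U, y u) ≤
      A * tsirelsonNorm K d θ (∑ u ∈ U, Finsupp.single u 1) + 1)
    (hc : 0 < c) (hy : ∀ u, c ≤ tsirelsonNorm k d θ (y u)) : False := by
  have hα : (List.replicate (K - (k + 1)) 0).Pairwise (· ≤ ·) := by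
    rw [List.pairwise_replicate]; right; exact le_rfl
  have hαl : (List.replicate (K - (k + 1)) 0).length + (k + 1) = K := by simp; omega
  have h2 := eventually_branchPart_lt hd h0 h1 hdθ hA0 hA (Nat.le_add_left 1 k) hα hαl
    (p := []) (by simp) hc
  have := extFilter_neBot (k + 1) (List.replicate (K - (k + 1)) 0)
  obtain ⟨l, h3, h4⟩ := (h2.and (eventually_extFilter 0 (k + 1) hα)).exists
  let u : Omega K := ⟨l, h4.2.1.trans hαl, h4.2.2.1⟩
  refine absurd ((h3 u rfl).trans_le (hy u)) (not_lt.2 (tsirelsonNorm_mono_abs h0 h1 fun v => ?_))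
  simp [branchPart_apply]

/-! ### From isomorphisms of the completions to finitely supported vectors -/

theorem isEmpty_equiv_of_lt {K k d : ℕ} (hk : k < K) {θ : Set.Ioo (0 : ℝ) 1}
    (hdθ : 1 < (d : ℝ) * θ) : IsEmpty (TsirelsonSpace K d θ ≃L[ℝ] TsirelsonSpace k d θ) := by
  refine ⟨fun Φ => ?_⟩
  have hd : 0 < d := by
    rcases Nat.eq_zero_or_pos d with rfl | h
    · norm_num at hdθ
    · exact h
  let e : Omega K → C00 K d θ := fun u => Finsupp.single u 1
  have he : ∀ u, 1 ≤ ‖e u‖ := by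
    intro u
    refine le_trans ?_ (abs_le_tsirelsonNorm θ.2.1 θ.2.2 (Finsupp.single u 1) u)
    simp
  obtain ⟨c, hc, hΦ⟩ : ∃ c : ℝ, 0 < c ∧ ∀ x, c * ‖x‖ ≤ ‖Φ x‖ := by
    refine ⟨(‖(Φ.symm : TsirelsonSpace k d θ →L[ℝ] TsirelsonSpace K d θ)‖ + 1)⁻¹, by positivity,
      fun x => ?_⟩
    rw [inv_mul_le_iff₀ (by positivity)]
    have h2 := (Φ.symm : TsirelsonSpace k d θ →L[ℝ] TsirelsonSpace K d θ).le_opNorm (Φ x)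
    simp only [ContinuousLinearEquiv.coe_coe, ContinuousLinearEquiv.symm_apply_apply] at h2
    nlinarith [norm_nonneg (Φ x)]
  -- Total error at most `c / 2` keeps the approximants bounded away from zero; total error at most
  -- `1` is the additive constant in the domination.
  obtain ⟨δ, hδ0, s, hδ, hs⟩ := posSumOfEncodable (show 0 < min (c / 2) 1 by positivity) (Omega K)
  have happ : ∀ u, ∃ a : C00 k d θ, ‖Φ (e u : TsirelsonSpace K d θ) - a‖ < δ u := by
    intro u
    obtain ⟨a, ha⟩ := UniformSpace.Completion.denseRange_coe.exists_dist_lt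
      (Φ (e u : TsirelsonSpace K d θ)) (hδ0 u)
    exact ⟨a, by rwa [dist_eq_norm] at ha⟩
  choose a ha using happ
  have hδs : ∀ U : Finset (Omega K), ∑ u ∈ U, δ u ≤ min (c / 2) 1 := fun U =>
    (sum_le_hasSum U (fun u _ => (hδ0 u).le) hδ).trans hs
  refine not_seminormalized_image hk hd θ.2.1 θ.2.2 hdθ (y := a) (c := c / 2)
    (norm_nonneg (Φ : TsirelsonSpace K d θ →L[ℝ] TsirelsonSpace k d θ)) (fun U => ?_)
    (by positivity) fun u => ?_
  · have h2 : ((∑ u ∈ U, a u : C00 k d θ) : TsirelsonSpace k d θ) =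
        Φ ((∑ u ∈ U, e u : C00 K d θ) : TsirelsonSpace K d θ) -
          ∑ u ∈ U, (Φ (e u : TsirelsonSpace K d θ) - a u) := by
      rw [← UniformSpace.Completion.coe_toComplL (𝕜 := ℝ), map_sum,
        ← UniformSpace.Completion.coe_toComplL (𝕜 := ℝ), map_sum, map_sum,
        Finset.sum_sub_distrib]
      abel
    have h3 : ‖((∑ u ∈ U, a u : C00 k d θ) : TsirelsonSpace k d θ)‖ ≤
        ‖(Φ : TsirelsonSpace K d θ →L[ℝ] TsirelsonSpace k d θ)‖ *
          ‖((∑ u ∈ U, e u : C00 K d θ) : TsirelsonSpace K d θ)‖ + 1 := by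
      rw [h2]
      refine (norm_sub_le _ _).trans (add_le_add
        ((Φ : TsirelsonSpace K d θ →L[ℝ] TsirelsonSpace k d θ).le_opNorm _) ?_)
      exact (norm_sum_le _ _).trans ((Finset.sum_le_sum fun u _ => (ha u).le).trans
        ((hδs U).trans (min_le_right _ _)))
    rw [UniformSpace.Completion.norm_coe, UniformSpace.Completion.norm_coe] at h3
    exact h3
  · have h2 := hΦ (e u)
    rw [UniformSpace.Completion.norm_coe] at h2
    have h3 : δ u ≤ c / 2 := by simpa using (hδs {u}).trans (min_le_left _ _)
    have h4 : ‖Φ (e u : TsirelsonSpace K d θ)‖ - ‖(a u : TsirelsonSpace k d θ)‖ ≤ _ :=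
      norm_sub_norm_le _ _
    rw [UniformSpace.Completion.norm_coe] at h4
    change c / 2 ≤ ‖a u‖
    nlinarith [ha u, he u]

end EllentuckBanach

theorem mainTheorem9 (d : ℕ) (θ : Set.Ioo (0 : ℝ) 1) (hdθ : 1 < (d : ℝ) * (θ : ℝ))
    (k₁ k₂ : ℕ) (hk₁ : 2 ≤ k₁) (hk₂ : 2 ≤ k₂) (hk : k₁ ≠ k₂) :
    IsEmpty (EllentuckBanach.TsirelsonSpace k₁ d θ ≃L[ℝ]
      EllentuckBanach.TsirelsonSpace k₂ d θ) := by
  rcases lt_or_gt_of_ne hk with h | h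
  · exact ⟨fun Φ => (EllentuckBanach.isEmpty_equiv_of_lt h hdθ).false Φ.symm⟩
  · exact EllentuckBanach.isEmpty_equiv_of_lt h hdθ
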